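/- Let $K$ be a non-archimedean local field, with ring of integers $\mathcal{O}_K$ and residue field $k$ of characteristic $p$, and let $G$ be a finite group acting $\mathcal{O}_K$-linearly (from the left) on $V=\mathbb{A}^n_{\mathcal{O}_K}=\mathrm{Spec}\,\mathcal{O}_K[x_1,\dots,x_n]$, hence from the right on $\mathcal{O}_K[x_1,\dots,x_n]$ and on its linear part $\mathcal{O}_K[x]_1=\bigoplus_i\mathcal{O}_K x_i$. Write $V_k=V\otimes_{\mathcal{O}_K}k$, with origin $o\in V_k$. Suppose that one of the following conditions holds: 1. $p\nmid\sharp G$; 2. $K=k((t))$ (so $\mathcal{O}_K=k[[t]]$) and the $G$-action on $V$ is the base change of a linear $G$-action on $\mathbb{A}^n_k$; 3. $G$ acts on $V$ by permutations of the coordinates. Let $M$ be a $G$-étale $K$-algebra, that is, a finite étale $K$-algebra of degree $\sharp G$ with a right action of $G$ by $K$-algebra automorphisms such that $M^G=K$, and let $\mathcal{O}_M$ be the integral closure of $\mathcal{O}_K$ in $M$. Let \[ \Xi_M=\{\phi\in\mathrm{Hom}_{\mathcal{O}_K}(\mathcal{O}_K[x]_1,\mathcal{O}_M)\mid \phi(fg)=\phi(f)g\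 \text{for all } f\in\mathcal{O}_K[x]_1,\ g\in G\} \] be the tuning module. Let $H_0\subset G$ be the stabilizer of a geometric connected component of $\mathrm{Spec}\,M$, that is, of a connected component of $\mathrm{Spec}(M\otimes_K K^{\mathrm{ur}})$ with $K^{\mathrm{ur}}$ the maximal unramified extension of $K$; let $(V_k)^{H_0}\subset V_k$ be the fixed-point subscheme. Then $\Xi_M$ is a free $\mathcal{O}_K$-module of rank $n$. Moreover, for every basis $\phi_1,\dots,\phi_n$ of $\Xi_M$, let $V^{\langle M\rangle}=\mathrm{Spec}\,\mathcal{O}_M[y_1,\dots,y_n]$, let $\eta:V^{\langle M\rangle}\to V$ be the morphism given by $x_i\mapsto\sum_{j}\phi_j(x_i)y_j$, and let $\eta_k:V^{\langle M\rangle}\otimes_{\mathcal{O}_K}k\to V_k$ be its base change. Then \[ \dim\eta_k^{-1}(o)=\mathrm{codim}\bigl((V_k)^{H_0}\subset V_k\bigr). \] -/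

import Mathlib

open scoped ValuativeRel TensorProduct
open MulOpposite

universe u v

noncomputable section

/-- `M` is a `G`-étale `K`-algebra: a finite étale `K`-algebra of degree `#G` with a right action
of `G` by `K`-algebra automorphisms (a right action of `G` is an action of `Gᵐᵒᵖ`) whose ring of
invariants is `K`. -/
class IsGEtale (K G M : Type*) [Field K] [Group G] [CommRing M] [Algebra K M]
    [MulSemiringAction Gᵐᵒᵖ M] [SMulCommClass Gᵐᵒᵖ K M] : Prop where
  etale : Algebra.Etale K M
  finite : Module.Finite K M
  finrank_eq : Module.finrank K M = Nat.card G
  invariant_iff : ∀ m : M, (∀ g : G, op g • m = m) ↔ m ∈ (algebraMap K M).range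

section MaximalUnramified

/-- The maximal unramified extension `K^ur` of `K` (inside a separable closure): the compositum of
all finite subextensions `F` whose ring of integers is unramified over that of `K`. -/
def maxUnramified (K : Type*) [Field K] [ValuativeRel K] :
    IntermediateField K (SeparableClosure K) :=
  sSup {F | FiniteDimensional K F ∧ Algebra.FormallyUnramified 𝒪[K] (integralClosure 𝒪[K] F)}

variable (K : Type*) {G : Type*} (M : Type*) [Field K] [ValuativeRel K] [Group G] [CommRing M]
  [Algebra K M] [MulSemiringAction Gᵐᵒᵖ M] [SMulCommClass Gᵐᵒᵖ K M]

/-- The ring automorphism of `M ⊗ K^ur` induced by the right action of `g` on `M`. -/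
def geomAct (g : G) : M ⊗[K] maxUnramified K →ₐ[K] M ⊗[K] maxUnramified K :=
  Algebra.TensorProduct.map (MulSemiringAction.toAlgHom K M (op g)) (AlgHom.id K _)

theorem geomAct_one : geomAct K M (1 : G) = AlgHom.id K _ := by
  ext <;> simp [geomAct]

theorem geomAct_mul (g h : G) :
    geomAct K M (g * h) = (geomAct K M h).comp (geomAct K M g) := by
  ext <;> simp [geomAct, mul_smul]

/-- The (left) action of `g` on `Spec (M ⊗ K^ur)`. -/
def geomActSpec (g : G) (z : PrimeSpectrum (M ⊗[K] maxUnramified K)) :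
    PrimeSpectrum (M ⊗[K] maxUnramified K) :=
  PrimeSpectrum.comap (geomAct K M g).toRingHom z

theorem geomActSpec_one : geomActSpec K M (1 : G) = id := by
  funext z
  simp only [geomActSpec, geomAct_one]
  rfl

theorem geomActSpec_mul (g h : G) :
    geomActSpec K M (g * h) = geomActSpec K M g ∘ geomActSpec K M h := by
  funext z
  simp only [geomActSpec, geomAct_mul]
  rfl

/-- The stabilizer in `G` of the geometric connected component of `Spec M`, i.e. of the connected
component of `Spec (M ⊗ K^ur)`, that contains the point `z`. -/
def geomStabilizer (G : Type*) [Group G] [MulSemiringAction Gᵐᵒᵖ M] [SMulCommClass Gᵐᵒᵖ K M]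
    (z : PrimeSpectrum (M ⊗[K] maxUnramified K)) : Subgroup G where
  carrier := {g | geomActSpec K M g '' connectedComponent z = connectedComponent z}
  mul_mem' {g h} hg hh := by
    simp only [Set.mem_ofPred_eq] at hg hh ⊢
    rw [geomActSpec_mul, Set.image_comp, hh, hg]
  one_mem' := by
    simp only [Set.mem_ofPred_eq, geomActSpec_one, Set.image_id]
  inv_mem' {g} hg := by
    simp only [Set.mem_ofPred_eq] at hg ⊢
    conv_lhs => rw [← hg]
    rw [← Set.image_comp, ← geomActSpec_mul, inv_mul_cancel, geomActSpec_one, Set.image_id]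

end MaximalUnramified

section Untwisting

variable {G : Type*} [Group G] {n : ℕ}

/-- A linear left action `v ↦ ρ g v` of `G` on `𝔸ⁿ` over `R` induces the right action
`f ↦ f ∘ ρ g` on the coordinate ring, `xᵢ ↦ ∑ⱼ (ρ g)ᵢⱼ xⱼ`. -/
def coordAct {R : Type*} [CommRing R] (ρ : G →* GL (Fin n) R) (g : G) :
    MvPolynomial (Fin n) R →ₐ[R] MvPolynomial (Fin n) R :=
  MvPolynomial.aeval fun i => ∑ j, MvPolynomial.C ((ρ g).1 i j) * MvPolynomial.X j

variable {K : Type*} [Field K] [ValuativeRel K] (ρ : G →* GL (Fin n) 𝒪[K])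
  (M : Type*) [CommRing M] [Algebra K M] [MulSemiringAction Gᵐᵒᵖ M]

/-- The tuning module `Ξ_M`: the `G`-equivariant `𝒪_K`-linear maps from the linear part of
`𝒪_K[x₁, …, xₙ]` to the ring of integers `𝒪_M` of `M`. The linear form `∑ᵢ cᵢ xᵢ` is given by its
coefficient vector `c`; the action of `g` sends it to the form with coefficient vector
`c ᵥ* ρ g`. -/
def tuningModule [SMulCommClass Gᵐᵒᵖ K M] :
    Submodule 𝒪[K] ((Fin n → 𝒪[K]) →ₗ[𝒪[K]] integralClosure 𝒪[K] M) where
  carrier := {φ | ∀ (g : G) (c : Fin n → 𝒪[K]),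
    (φ (Matrix.vecMul c (ρ g).1) : M) = op g • (φ c : M)}
  add_mem' {φ ψ} hφ hψ g c := by
    simp only [Set.mem_ofPred_eq] at hφ hψ
    simp [hφ, hψ]
  zero_mem' g c := by simp
  smul_mem' a φ hφ g c := by
    simp only [Set.mem_ofPred_eq] at hφ
    have h : ∀ m : M, op g • (a • m) = a • (op g • m) := fun m =>
      smul_comm (op g) (a : K) m
    simp [hφ, h]

variable {M}

/-- `u^* : 𝒪_K[x] → 𝒪_M[y]`, `xᵢ ↦ ∑ⱼ φⱼ(xᵢ) yⱼ`, for linear maps `φ₁, …, φₙ` from the linear part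
of `𝒪_K[x]` to `𝒪_M`. -/
def untwist (φ : Fin n → ((Fin n → 𝒪[K]) →ₗ[𝒪[K]] integralClosure 𝒪[K] M)) :
    MvPolynomial (Fin n) 𝒪[K] →ₐ[𝒪[K]] MvPolynomial (Fin n) (integralClosure 𝒪[K] M) :=
  MvPolynomial.aeval fun i =>
    ∑ j, MvPolynomial.C (φ j (Pi.single i 1)) * MvPolynomial.X j

end Untwisting

section SpecialFibre

variable (K : Type*) [Field K] [ValuativeRel K] (n : ℕ)

/-- The coordinate ring `k ⊗ 𝒪_K[x₁, …, xₙ]` of the special fibre `V_k` of `V = 𝔸ⁿ` over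
`𝒪_K`. -/
abbrev SpecialCoordRing : Type _ := 𝓀[K] ⊗[𝒪[K]] MvPolynomial (Fin n) 𝒪[K]

/-- The origin of `V_k`: the image of `Spec k → V_k` given by `xᵢ ↦ 0`. -/
def origin : PrimeSpectrum (SpecialCoordRing K n) :=
  PrimeSpectrum.comap
    (Algebra.TensorProduct.lift (AlgHom.id 𝓀[K] 𝓀[K])
      (MvPolynomial.aeval (R := 𝒪[K]) (fun _ : Fin n => (0 : 𝓀[K])))
      (fun _ _ => Commute.all _ _)).toRingHom ⊥

variable {K n} {G : Type*} [Group G]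

/-- The ideal in the coordinate ring of `V_k` of the fixed-point subscheme `(V_k)^H`, i.e. of the
largest closed subscheme of `V_k` on which every element of `H` acts trivially. -/
def fixedIdeal (ρ : G →* GL (Fin n) 𝒪[K]) (H : Subgroup G) : Ideal (SpecialCoordRing K n) :=
  Ideal.span {a | ∃ h ∈ H, ∃ f : SpecialCoordRing K n,
    a = Algebra.TensorProduct.map (AlgHom.id 𝒪[K] 𝓀[K]) (coordAct ρ h) f - f}

end SpecialFibre

section Eta

open AlgebraicGeometry CategoryTheory

variable {K : Type u} [Field K] [ValuativeRel K] {n : ℕ} {M : Type u} [CommRing M] [Algebra K M]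

/-- `η_k : V^⟨M⟩ ⊗ k → V_k`, the base change along `𝒪_K → k` of
`η : V^⟨M⟩ = Spec 𝒪_M[y] → V = Spec 𝒪_K[x]`, `η^* = u^*`. -/
def etaSpecial (φ : Fin n → ((Fin n → 𝒪[K]) →ₗ[𝒪[K]] integralClosure 𝒪[K] M)) :
    Spec (CommRingCat.of
        (𝓀[K] ⊗[𝒪[K]] MvPolynomial (Fin n) (integralClosure 𝒪[K] M))) ⟶
      Spec (CommRingCat.of (SpecialCoordRing K n)) :=
  Spec.map (CommRingCat.ofHom
    (Algebra.TensorProduct.map (AlgHom.id 𝒪[K] 𝓀[K]) (untwist φ)).toRingHom)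

end Eta

end

/-! Evaluation at the coordinates identifies the tuning module with the vectors `v` over `𝒪_M`
satisfying `ρ(g) v = g • v` for all `g` (`equivariantVectors`). Such vectors arise as relative
traces: if `b ∈ 𝒪_M` and `w ∈ 𝒪_K^n` are fixed by a subgroup `I`, the sum of `g⁻¹b ⊗ ρ(g)w` over the
cosets `gI` is equivariant. If a homomorphism `θ` from `𝒪_M` to a field detects the elements outside
`I` on the `I`-invariants, then Dedekind's independence of characters writes `θ(w)` as a combination
of images of these traces (`comp_mem_span_equivariantVectors`).

With `I` trivial and `θ` a geometric point, the equivariant vectors span the generic `n`-space. A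
Cramer's rule argument embeds them into `𝒪_K^n`, so they are free of rank `n`
(`free_finrank_equivariantVectors`).

With `θ` the reduction modulo a maximal ideal `P` and `I` its inertia group, equivariant vectors
reduce to `I`-fixed vectors, and the traces produce every fixed vector that lifts to a fixed vector
over `𝒪_K`. The three conditions enter only through this lifting. Hence the columns of the matrix
`(φⱼ(xᵢ))` mod `P` span the fixed space, and its kernel has the complementary dimension
(`finrank_linZeros_add_finrank_linZeros_fixedForms`). For a suitable `P` the inertia group is `H₀`
(`mem_geomStabilizer_iff_forall_op_smul_sub_mem`).

Up to nilpotents, the fibre over the origin is a disjoint union of such kernels, one for each prime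
of `𝒪_M` above the maximal ideal. These primes are conjugate under `G`, so all pieces have the same
dimension, namely the codimension of the fixed space. -/

noncomputable section

/-! ### Relative traces and the lattice of equivariant vectors. -/

section EquivariantVectors

open Matrix

/-- Separating one character from finitely many others. -/
theorem pi_single_mem_span_range_of_ne {X A F : Type*} [Finite X] [DecidableEq X] [Monoid A]
    [Field F] (ψ : X → A →* F) (x₀ : X) (h : ∀ x, x ≠ x₀ → ψ x ≠ ψ x₀) :
    (Pi.single x₀ 1 : X → F) ∈ Submodule.span F (Set.range fun a x => ψ x a) := by
  cases nonempty_fintype X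
  by_contra hn
  obtain ⟨f, hf0, hf⟩ := Submodule.exists_le_ker_of_notMem hn
  have key : ∀ v : X → F, f v = ∑ x, v x * f (Pi.single x 1) := fun v => by
    conv_lhs => rw [pi_eq_sum_univ' v]
    simp [map_sum]
  -- A functional killing the span gives a linear relation between characters. The `ψ x` with `x ≠
  -- x₀` may coincide with one another, but none contributes to the coefficient of `ψ x₀`.
  have h0 : ∑ x, Finsupp.single (ψ x) (f (Pi.single x 1)) = 0 := by
    refine linearIndependent_iff.mp (linearIndependent_monoidHom A F) _ ?_
    ext a
    have := hf (Submodule.subset_span ⟨a, rfl⟩)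
    rw [LinearMap.mem_ker, key] at this
    simpa [map_sum, Finset.sum_apply, mul_comm] using this
  have h1 := DFunLike.congr_fun h0 (ψ x₀)
  rw [Finsupp.finsetSum_apply, Finset.sum_eq_single x₀] at h1
  · exact hf0 (by simpa using h1)
  · intro x _ hx
    simp [h x hx]
  · simp

/-- For a group acting on a ring with inertia group `I` at the prime `P`, elements outside `I` are
detected modulo `P` on the invariants of `I`. -/
theorem exists_fixed_smul_sub_notMem {Γ A : Type*} [Group Γ] [Finite Γ] [CommRing A]
    [MulSemiringAction Γ A] (P : Ideal A) [P.IsPrime] (I : Subgroup Γ)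
    (hI : ∀ g, g ∈ I ↔ ∀ x : A, g • x - x ∈ P) {g : Γ} (hg : g ∉ I) :
    ∃ b : A, (∀ h ∈ I, h • b = b) ∧ g • b - b ∉ P := by
  by_contra! H
  refine hg ((hI g).mpr fun x => ?_)
  cases nonempty_fintype I
  -- The coefficients of `∏ (X - h • x)`, `h ∈ I`, are `I`-invariant, so `g` fixes them mod `P`.
  -- Applying `g` to `f(x) = 0` makes `g • x` a root of `f` mod `P`, hence congruent to some `h •
  -- x`, which is congruent to `x`.
  set f := MulSemiringAction.charpoly I x with hf
  have hcoeff : ∀ i, g • f.coeff i - f.coeff i ∈ P := fun i => H _ fun h hh => by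
    have := MulSemiringAction.smul_coeff_charpoly x i (⟨h, hh⟩ : I)
    simpa using this
  have h1 : Ideal.Quotient.mk P (f.eval (g • x)) = 0 := by
    have h2 : g • f.eval x = 0 := by rw [hf, MulSemiringAction.eval_charpoly, smul_zero]
    rw [Polynomial.eval_eq_sum_range, Finset.smul_sum] at h2
    rw [Polynomial.eval_eq_sum_range, ← map_zero (Ideal.Quotient.mk P), ← h2, map_sum, map_sum]
    refine Finset.sum_congr rfl fun i _ => ?_
    rw [smul_mul', smul_pow', map_mul, map_mul]
    congr 1
    exact ((Ideal.Quotient.mk_eq_mk_iff_sub_mem _ _).mpr (hcoeff i)).symm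
  rw [hf, MulSemiringAction.charpoly_eq, Polynomial.eval_prod, map_prod] at h1
  obtain ⟨h, _, hh⟩ := Finset.prod_eq_zero_iff.mp h1
  simp only [Polynomial.eval_sub, Polynomial.eval_X, Polynomial.eval_C] at hh
  rw [Ideal.Quotient.eq_zero_iff_mem] at hh
  have := P.add_mem hh ((hI h.1).mp h.2 x)
  simpa [Subgroup.smul_def] using this

variable {G R A : Type*} [Group G] [CommRing R] [CommRing A] [Algebra R A]
  [MulSemiringAction Gᵐᵒᵖ A] [SMulCommClass Gᵐᵒᵖ R A] {n : ℕ}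

theorem op_smul_algebraMap (g : G) (r : R) : op g • algebraMap R A r = algebraMap R A r := by
  rw [Algebra.algebraMap_eq_smul_one, smul_comm, smul_one]

variable (A) in
/-- Vectors over `A` on which the linear action of `G` agrees with its action on `A`. -/
def equivariantVectors (ρ : G →* GL (Fin n) R) : Submodule R (Fin n → A) where
  carrier := {v | ∀ g : G, (ρ g).1.map (algebraMap R A) *ᵥ v = op g • v}
  add_mem' {v w} hv hw g := by
    simp only [Set.mem_ofPred_eq] at hv hw
    rw [mulVec_add, hv, hw, smul_add]
  zero_mem' g := by simp
  smul_mem' a v hv g := by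
    simp only [Set.mem_ofPred_eq] at hv
    rw [mulVec_smul, hv]
    ext i
    exact (smul_comm (op g) a (v i)).symm

theorem mem_equivariantVectors {ρ : G →* GL (Fin n) R} {v : Fin n → A} :
    v ∈ equivariantVectors A ρ ↔
      ∀ g : G, (ρ g).1.map (algebraMap R A) *ᵥ v = op g • v := Iff.rfl

theorem map_mulVec_algebraMap_comp (B : Matrix (Fin n) (Fin n) R) (w : Fin n → R) :
    B.map (algebraMap R A) *ᵥ (algebraMap R A ∘ w) = algebraMap R A ∘ (B *ᵥ w) := by
  ext i
  simp [mulVec, dotProduct]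

/-- The relative trace of `b ⊗ w` from `I` to `G`. -/
theorem sum_quotient_mem_equivariantVectors [Finite G] (ρ : G →* GL (Fin n) R) (I : Subgroup G)
    [Fintype (G ⧸ I)] {b : A} (hb : ∀ h ∈ I, op h • b = b) {w : Fin n → R}
    (hw : ∀ h ∈ I, (ρ h).1 *ᵥ w = w) :
    (∑ x : G ⧸ I, (op x.out⁻¹ • b) • (algebraMap R A ∘ ((ρ x.out).1 *ᵥ w))) ∈
      equivariantVectors A ρ := by
  -- The summand depends only on the coset, so left multiplication by `s` just permutes the sum.
  have key : ∀ g : G, (op (QuotientGroup.mk g : G ⧸ I).out⁻¹ • b) •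
      (algebraMap R A ∘ ((ρ (QuotientGroup.mk g : G ⧸ I).out).1 *ᵥ w)) =
      (op g⁻¹ • b) • (algebraMap R A ∘ ((ρ g).1 *ᵥ w)) := fun g => by
    obtain ⟨h, hh⟩ := QuotientGroup.mk_out_eq_mul I g
    rw [hh, _root_.mul_inv_rev, op_mul, mul_smul, hb _ (I.inv_mem h.2), map_mul, Units.val_mul,
      ← mulVec_mulVec, hw _ h.2]
  intro s
  rw [Finset.smul_sum, mulVec_sum,
    ← Equiv.sum_comp (MulAction.toPerm s : Equiv.Perm (G ⧸ I)) fun x => op s • _]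
  refine Finset.sum_congr rfl fun x _ => ?_
  induction x using QuotientGroup.induction_on with | H g
  simp only [MulAction.toPerm_apply, MulAction.Quotient.smul_mk, key, smul_eq_mul]
  rw [mulVec_smul, map_mulVec_algebraMap_comp, mulVec_mulVec, ← Units.val_mul, ← map_mul]
  ext i
  simp [smul_mul', ← mul_smul, ← op_mul]

/-- A vector over `R` fixed by `I` is, over a field, a combination of equivariant vectors,
provided the field separates `I` from the rest of `G` on the `I`-invariants. -/
theorem comp_mem_span_equivariantVectors [Finite G] {F : Type*} [Field F] (θ : A →+* F)
    (ρ : G →* GL (Fin n) R) (I : Subgroup G)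
    (hI : ∀ g ∉ I, ∃ b : A, (∀ h ∈ I, op h • b = b) ∧ θ (op g • b) ≠ θ b)
    {w : Fin n → R} (hw : ∀ h ∈ I, (ρ h).1 *ᵥ w = w) :
    (θ ∘ algebraMap R A ∘ w) ∈
      Submodule.span F ((θ ∘ ·) '' (equivariantVectors A ρ : Set (Fin n → A))) := by
  classical
  cases nonempty_fintype (G ⧸ I)
  let B : Submonoid A :=
    { carrier := {b | ∀ h ∈ I, op h • b = b}
      mul_mem' := fun ha hb h hh => by rw [smul_mul', ha h hh, hb h hh]
      one_mem' := fun h _ => smul_one _ }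
  let ψ : G ⧸ I → B →* F := fun x =>
    { toFun := fun b => θ (op x.out⁻¹ • b.1)
      map_one' := by simp
      map_mul' := fun a b => by simp [smul_mul'] }
  have hout : ((1 : G) : G ⧸ I).out ∈ I := by
    obtain ⟨h, hh⟩ := QuotientGroup.mk_out_eq_mul I 1
    rw [hh, one_mul]; exact h.2
  have hψ : ∀ x, x ≠ ((1 : G) : G ⧸ I) → ψ x ≠ ψ ((1 : G) : G ⧸ I) := fun x hx he => by
    have hx' : x.out⁻¹ ∉ I := fun hm => hx <| by
      rw [← QuotientGroup.out_eq' x, eq_comm, QuotientGroup.eq, inv_one, one_mul]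
      simpa using hm
    obtain ⟨b, hb, hne⟩ := hI _ hx'
    have := DFunLike.congr_fun he ⟨b, hb⟩
    simp only [ψ, MonoidHom.coe_mk, OneHom.coe_mk, hb _ (I.inv_mem hout)] at this
    exact hne this
  have hspan := pi_single_mem_span_range_of_ne ψ ((1 : G) : G ⧸ I) hψ
  -- On the tuple `(ψ x b)ₓ` this map gives the image under `θ` of the relative trace of `b ⊗ w`. On
  -- the indicator of the trivial coset it gives the image of `w`.
  let Λ : (G ⧸ I → F) →ₗ[F] (Fin n → F) :=
    ∑ x, (LinearMap.proj x).smulRight (θ ∘ algebraMap R A ∘ ((ρ x.out).1 *ᵥ w))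
  have hΛ : Λ (Pi.single ((1 : G) : G ⧸ I) 1) = θ ∘ algebraMap R A ∘ w := by
    simp only [Λ, LinearMap.sum_apply, LinearMap.smulRight_apply, LinearMap.proj_apply]
    rw [Finset.sum_eq_single ((1 : G) : G ⧸ I) (fun x _ hx => by simp [hx]) (by simp)]
    simp [hw _ hout]
  rw [← hΛ]
  have := Submodule.mem_map_of_mem (f := Λ) hspan
  rw [Submodule.map_span] at this
  refine Submodule.span_mono ?_ this
  rintro _ ⟨_, ⟨b, rfl⟩, rfl⟩
  refine ⟨_, sum_quotient_mem_equivariantVectors ρ I b.2 hw, ?_⟩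
  ext i
  simp [Λ, ψ]

/-- The equivariant vectors form a lattice of rank `n` as soon as they span generically. -/
theorem free_finrank_equivariantVectors [IsDomain R] [IsPrincipalIdealRing R] [Finite G]
    [Algebra.IsInvariant R A Gᵐᵒᵖ] {F : Type*} [Field F] (θ : A →+* F)
    (hR : Function.Injective (θ.comp (algebraMap R A)))
    (hA : ∀ a : A, (∀ g : G, θ (op g • a) = 0) → a = 0) (ρ : G →* GL (Fin n) R)
    (v : Fin n → Fin n → A) (hv : ∀ j, v j ∈ equivariantVectors A ρ)
    (hli : LinearIndependent F fun j => θ ∘ v j) :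
    Nonempty (Module.Basis (Fin n) R (equivariantVectors A ρ)) := by
  classical
  have : Finite Gᵐᵒᵖ := Finite.of_equiv G MulOpposite.opEquiv
  cases nonempty_fintype Gᵐᵒᵖ
  set Φ : Matrix (Fin n) (Fin n) A := (Matrix.of v)ᵀ with hΦ
  have hΦg : ∀ g : G, Φ.map (op g • ·) = (ρ g).1.map (algebraMap R A) * Φ := fun g => by
    ext i j
    exact (congrFun (hv j g) i).symm
  have hΦ0 : θ Φ.det ≠ 0 := by
    have h1 : (Φ.map θ).det ≠ 0 := by
      rw [← isUnit_iff_ne_zero, ← isUnit_iff_isUnit_det, ← linearIndependent_cols_iff_isUnit]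
      exact hli
    rwa [← RingHom.mapMatrix_apply, ← RingHom.map_det] at h1
  have hdet : ∀ g : G, θ (op g • Φ.det) ≠ 0 := fun g => by
    have h1 : op g • Φ.det = algebraMap R A (ρ g).1.det * Φ.det := by
      rw [RingHom.map_det, ← det_mul, RingHom.mapMatrix_apply, ← hΦg]
      exact (MulSemiringAction.toRingHom Gᵐᵒᵖ A (op g)).map_det Φ
    rw [h1, map_mul]
    refine mul_ne_zero ?_ hΦ0
    have h2 : IsUnit (ρ g).1.det := (isUnit_iff_isUnit_det _).mp (ρ g).isUnit
    exact (h2.map (θ.comp (algebraMap R A))).ne_zero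
  -- The cofactor of `det Φ` in its norm, so that `det Φ * e` descends to some `r : R`.
  set e : A := ∏ γ ∈ Finset.univ.erase (1 : Gᵐᵒᵖ), γ • Φ.det with he
  have hD : Φ.det * e = ∏ γ : Gᵐᵒᵖ, γ • Φ.det := by
    rw [← Finset.mul_prod_erase _ _ (Finset.mem_univ (1 : Gᵐᵒᵖ)), one_smul]
  obtain ⟨r, hr⟩ : ∃ r, algebraMap R A r = Φ.det * e := by
    refine Algebra.IsInvariant.isInvariant (G := Gᵐᵒᵖ) _ fun γ => ?_
    rw [hD, Finset.smul_prod']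
    exact Fintype.prod_equiv (Equiv.mulLeft γ) _ _ fun δ => by simp [mul_smul]
  have hr0 : θ (algebraMap R A r) ≠ 0 := by
    rw [hr, hD, map_prod]
    exact Finset.prod_ne_zero_iff.mpr fun γ _ => hdet γ.unop
  have hreg : ∀ a : A, Φ.det * a = 0 → a = 0 := fun a ha => hA a fun g => by
    have h1 : θ (op g • (Φ.det * a)) = 0 := by rw [ha, smul_zero, map_zero]
    rw [smul_mul', map_mul] at h1
    exact (mul_eq_zero.mp h1).resolve_left (hdet g)
  -- This is `x ↦ r Φ⁻¹ x`. Both `Φ` and `x` are multiplied by `ρ g` under the action of `g`, so the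
  -- coordinates of the result are `G`-invariant and lie in `R`.
  let ι : equivariantVectors A ρ →ₗ[R] (Fin n → A) :=
    (((e • Φ.adjugate).mulVecLin).restrictScalars R).comp (equivariantVectors A ρ).subtype
  have hι : ∀ x, Φ *ᵥ ι x = r • (x : Fin n → A) := fun x => by
    simp only [ι, LinearMap.comp_apply, Submodule.subtype_apply, LinearMap.restrictScalars_apply,
      mulVecLin_apply]
    rw [mulVec_mulVec, mul_smul_comm, mul_adjugate, smul_smul, mul_comm, ← hr, smul_mulVec,
      one_mulVec, algebraMap_smul]
  have hΦinj : ∀ w : Fin n → A, Φ *ᵥ w = 0 → w = 0 := fun w hw => by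
    have h1 : (Φ.adjugate * Φ) *ᵥ w = 0 := by rw [← mulVec_mulVec, hw, mulVec_zero]
    rw [adjugate_mul, smul_mulVec, one_mulVec] at h1
    ext i
    exact hreg _ (congrFun h1 i)
  have hιinj : Function.Injective ι := by
    rw [← LinearMap.ker_eq_bot, LinearMap.ker_eq_bot']
    intro x hx
    have h1 := hι x
    rw [hx, mulVec_zero] at h1
    ext i
    refine hA _ fun g => ?_
    have h2 := congrArg (fun a => θ (op g • a)) (congrFun h1 i).symm
    simp only [Pi.smul_apply, Pi.zero_apply, smul_zero, map_zero, Algebra.smul_def, smul_mul',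
      op_smul_algebraMap, map_mul] at h2
    exact (mul_eq_zero.mp h2).resolve_left hr0
  let α : (Fin n → R) →ₗ[R] (Fin n → A) := (Algebra.linearMap R A).compLeft (Fin n)
  have hα : Function.Injective α := fun a b hab => by
    ext i
    exact hR (congrArg θ (congrFun hab i))
  have hrange : LinearMap.range ι ≤ LinearMap.range α := by
    rintro _ ⟨x, rfl⟩
    have hfix : ∀ g : G, op g • ι x = ι x := fun g => by
      have h1 : Φ.map (op g • ·) *ᵥ (op g • ι x) = r • op g • (x : Fin n → A) := by
        have h2 := congrArg (op g • ·) (hι x)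
        ext i
        have h3 := congrFun h2 i
        simp only [Pi.smul_apply, mulVec, dotProduct, Finset.smul_sum, smul_mul'] at h3 ⊢
        rw [smul_comm] at h3
        exact h3
      rw [hΦg, ← x.2 g, ← mulVec_smul, ← hι, ← mulVec_mulVec] at h1
      have h4 := congrArg ((ρ g⁻¹).1.map (algebraMap R A) *ᵥ ·) h1
      simp only [mulVec_mulVec, ← Matrix.mul_assoc, ← Matrix.map_mul, ← Units.val_mul,
        ← map_mul, inv_mul_cancel] at h4
      simp only [map_one, Units.val_one, Matrix.map_one _ (map_zero _) (map_one _),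
        Matrix.one_mul] at h4
      exact sub_eq_zero.mp (hΦinj _ (by rw [mulVec_sub, h4, sub_self]))
    choose c hc using fun i => Algebra.IsInvariant.isInvariant (A := R) (G := Gᵐᵒᵖ) (ι x i)
      fun γ => congrFun (hfix γ.unop) i
    exact ⟨c, funext hc⟩
  let β : equivariantVectors A ρ →ₗ[R] (Fin n → R) :=
    (LinearEquiv.ofInjective α hα).symm.toLinearMap.comp
      ((Submodule.inclusion hrange).comp ι.rangeRestrict)
  have hβ : Function.Injective β :=
    (LinearEquiv.ofInjective α hα).symm.injective.comp
      ((Submodule.inclusion_injective hrange).comp fun a b hab =>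
        hιinj (congrArg Subtype.val hab))
  have : Module.Finite R (equivariantVectors A ρ) := Module.Finite.of_injective β hβ
  have : Module.Free R (equivariantVectors A ρ) :=
    Module.Free.of_equiv (LinearEquiv.ofInjective β hβ).symm
  have hle : Module.finrank R (equivariantVectors A ρ) ≤ n := by
    simpa using LinearMap.finrank_le_finrank_of_injective hβ
  have hge : n ≤ Module.finrank R (equivariantVectors A ρ) := by
    let δ : (Fin n → R) →ₗ[R] equivariantVectors A ρ :=
      Fintype.linearCombination R fun j => (⟨v j, hv j⟩ : equivariantVectors A ρ)
    have hδ : Function.Injective δ := by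
      rw [← LinearMap.ker_eq_bot, LinearMap.ker_eq_bot']
      intro c hc
      have h1 : Φ *ᵥ α c = 0 := by
        have h2 := congrArg Subtype.val hc
        ext i
        have h3 := congrFun h2 i
        simp only [δ, Fintype.linearCombination_apply, Submodule.coe_sum, Submodule.coe_smul,
          Finset.sum_apply, Algebra.smul_def] at h3
        simpa [mulVec, dotProduct, α, hΦ, mul_comm] using h3
      exact hα (by rw [hΦinj _ h1, map_zero])
    simpa using LinearMap.finrank_le_finrank_of_injective hδ
  exact ⟨(Module.finBasisOfFinrankEq R _ (le_antisymm hle hge))⟩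

end EquivariantVectors

/-! ### Ideals generated by linear forms: dimension and height. -/

section LinearForms

open MvPolynomial

variable {n : ℕ} {F : Type*} [Field F]

/-- The linear form with the given coefficients. -/
def linForm {A : Type*} [CommRing A] (a : Fin n → A) : MvPolynomial (Fin n) A :=
  ∑ j, C (a j) * X j

theorem linForm_add {A : Type*} [CommRing A] (a b : Fin n → A) :
    linForm (a + b) = linForm a + linForm b := by
  simp [linForm, add_mul, Finset.sum_add_distrib]

theorem linForm_smul {A : Type*} [CommRing A] (c : A) (a : Fin n → A) :
    linForm (c • a) = C c * linForm a := by
  simp [linForm, Finset.mul_sum, mul_assoc]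

/-- The common zeros of the linear forms with coefficient vectors in `S`. -/
def linZeros (S : Set (Fin n → F)) : Submodule F (Fin n → F) where
  carrier := {y | ∀ a ∈ S, a ⬝ᵥ y = 0}
  add_mem' hx hy a ha := by rw [dotProduct_add, hx a ha, hy a ha, add_zero]
  zero_mem' a _ := dotProduct_zero a
  smul_mem' c x hx a ha := by rw [dotProduct_smul, hx a ha, smul_zero]

theorem mem_linZeros {S : Set (Fin n → F)} {y : Fin n → F} :
    y ∈ linZeros S ↔ ∀ a ∈ S, a ⬝ᵥ y = 0 := Iff.rfl

/-- Double annihilator: a vector outside the span of `S` is detected by a functional vanishing on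
`S`, and such a functional is the pairing with a common zero. -/
theorem linForm_mem_span_of_forall_linZeros {S : Set (Fin n → F)} {a : Fin n → F}
    (ha : ∀ y ∈ linZeros S, a ⬝ᵥ y = 0) : linForm a ∈ Ideal.span (linForm '' S) := by
  have h1 : a ∈ Submodule.span F S := by
    by_contra hn
    obtain ⟨f, hf0, hf⟩ := Submodule.exists_le_ker_of_notMem hn
    have key : ∀ v, v ⬝ᵥ (fun j => f (Pi.single j 1)) = f v := fun v => by
      conv_rhs => rw [pi_eq_sum_univ' v]
      simp [map_sum, dotProduct]
    refine hf0 ?_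
    rw [← key]
    refine ha _ fun s hs => ?_
    rw [key]
    exact hf (Submodule.subset_span hs)
  clear ha
  induction h1 using Submodule.span_induction with
  | mem x hx => exact Ideal.subset_span ⟨x, hx, rfl⟩
  | zero => simp [linForm]
  | add x y _ _ hx hy =>
    rw [linForm_add]
    exact Ideal.add_mem _ hx hy
  | smul c x _ hx =>
    rw [linForm_smul]
    exact Ideal.mul_mem_left _ _ hx

/-- The quotient of a polynomial ring by linear forms is a polynomial ring on their zero space. -/
theorem nonempty_quotient_span_linForm_algEquiv (S : Set (Fin n → F)) :
    Nonempty ((MvPolynomial (Fin n) F ⧸ Ideal.span (linForm '' S)) ≃ₐ[F]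
      MvPolynomial (Fin (Module.finrank F (linZeros S))) F) := by
  set Z := linZeros S
  let b := Module.finBasis F Z
  obtain ⟨q, hq⟩ := Z.subtype.exists_leftInverse_of_injective Z.ker_subtype
  have hq' : ∀ z : Z, q z = z := fun z => LinearMap.congr_fun hq z
  let π : MvPolynomial (Fin n) F →ₐ[F] MvPolynomial (Fin (Module.finrank F Z)) F :=
    aeval fun i => ∑ l, C ((b l : Fin n → F) i) * X l
  -- `π` restricts polynomials to the zero space `Z`; `s` pulls them back along a linear projection
  -- `q` onto `Z`, so `s` is a section of `π`.
  let s : MvPolynomial (Fin (Module.finrank F Z)) F →ₐ[F] MvPolynomial (Fin n) F :=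
    aeval fun l => linForm fun j => b.repr (q (Pi.single j 1)) l
  have hrepr : ∀ (y : Fin n → F) l, ∑ j, b.repr (q (Pi.single j 1)) l * y j = b.repr (q y) l :=
    fun y l => by
      conv_rhs => rw [pi_eq_sum_univ' y]
      simp [map_sum, mul_comm, Finsupp.finsetSum_apply]
  have hπs : π.comp s = AlgHom.id F _ := by
    ext1 l
    simp only [π, s, AlgHom.comp_apply, aeval_X, linForm, map_sum, map_mul, aeval_C, algebraMap_eq,
      Finset.mul_sum, AlgHom.id_apply]
    rw [Finset.sum_comm]
    simp only [← mul_assoc, ← C_mul, ← Finset.sum_mul, ← map_sum, hrepr, hq']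
    rw [Finset.sum_eq_single l] <;> simp +contextual
  have hmem : ∀ f, f - s (π f) ∈ Ideal.span (linForm '' S) := fun f => by
    rw [← Ideal.Quotient.mk_eq_mk_iff_sub_mem]
    refine DFunLike.congr_fun (f := Ideal.Quotient.mkₐ F (Ideal.span (linForm '' S)))
      (g := (Ideal.Quotient.mkₐ F (Ideal.span (linForm '' S))).comp (s.comp π)) ?_ f
    ext1 i
    refine (Ideal.Quotient.mk_eq_mk_iff_sub_mem _ _).mpr ?_
    have h1 : X i - s (π (X i)) = linForm
        (Pi.single i 1 - ∑ l, (b l : Fin n → F) i • fun j => b.repr (q (Pi.single j 1)) l) := by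
      have h2 : ∀ k, s (X k) = linForm fun j => b.repr (q (Pi.single j 1)) k := fun k =>
        aeval_X _ _
      have h3 : π (X i) = ∑ l, C ((b l : Fin n → F) i) * X l := aeval_X _ _
      rw [sub_eq_iff_eq_add, h3, map_sum]
      have h4 : ∀ k, s (C ((b k : Fin n → F) i) * X k) =
          linForm ((b k : Fin n → F) i • fun j => b.repr (q (Pi.single j 1)) k) := fun k => by
        rw [map_mul, h2, linForm_smul]
        simp [s]
      have h5 : ∀ (t : Finset (Fin (Module.finrank F Z))) (a : Fin (Module.finrank F Z) → Fin n → F),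
          linForm (∑ k ∈ t, a k) = ∑ k ∈ t, linForm (a k) := fun t a => by
        classical
        induction t using Finset.induction_on with
        | empty => simp [linForm]
        | insert k t hk ih => rw [Finset.sum_insert hk, Finset.sum_insert hk, linForm_add, ih]
      rw [Finset.sum_congr rfl fun k _ => h4 k, ← h5, ← linForm_add, sub_add_cancel]
      simp [linForm, Pi.single_apply]
    change X i - s (π (X i)) ∈ _
    rw [h1]
    refine linForm_mem_span_of_forall_linZeros fun y hy => ?_
    rw [sub_dotProduct, single_dotProduct, one_mul, sum_dotProduct]
    simp only [dotProduct, Pi.smul_apply, smul_eq_mul, mul_assoc, ← Finset.mul_sum, hrepr]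
    have h2 := congrFun (congrArg Subtype.val (b.sum_repr ⟨y, hy⟩)) i
    have h3 : q y = ⟨y, hy⟩ := hq' ⟨y, hy⟩
    simp only [Submodule.coe_sum, Submodule.coe_smul, Finset.sum_apply, Pi.smul_apply,
      smul_eq_mul] at h2
    rw [h3, ← h2, sub_eq_zero]
    exact Finset.sum_congr rfl fun _ _ => mul_comm _ _
  have hker : RingHom.ker π = Ideal.span (linForm '' S) := by
    refine le_antisymm (fun f hf => ?_) (Ideal.span_le.mpr ?_)
    · have := hmem f
      rwa [(hf : π f = 0), map_zero, sub_zero] at this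
    · rintro _ ⟨a, ha, rfl⟩
      have : ∀ l, ∑ j, a j * (b l : Fin n → F) j = 0 := fun l => (b l).2 a ha
      simp only [SetLike.mem_coe, RingHom.mem_ker, linForm, π, map_sum, map_mul, aeval_X, aeval_C,
        algebraMap_eq, Finset.mul_sum]
      rw [Finset.sum_comm]
      simp only [← mul_assoc, ← C_mul, ← Finset.sum_mul, ← map_sum, this, map_zero, zero_mul,
        Finset.sum_const_zero]
  rw [← hker]
  exact ⟨Ideal.quotientKerAlgEquivOfRightInverse (g := s) fun x => DFunLike.congr_fun hπs x⟩

theorem isPrime_span_linForm (S : Set (Fin n → F)) : (Ideal.span (linForm '' S)).IsPrime := by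
  obtain ⟨e⟩ := nonempty_quotient_span_linForm_algEquiv S
  rw [← Ideal.Quotient.isDomain_iff_prime]
  exact e.toRingEquiv.isDomain_iff.mpr inferInstance

theorem ringKrullDim_mvPolynomial_fin (d : ℕ) : ringKrullDim (MvPolynomial (Fin d) F) = d := by
  rw [MvPolynomial.ringKrullDim_of_isNoetherianRing, ringKrullDim_eq_zero_of_field]
  simp

theorem ringKrullDim_quotient_span_linForm (S : Set (Fin n → F)) :
    ringKrullDim (MvPolynomial (Fin n) F ⧸ Ideal.span (linForm '' S)) =
      Module.finrank F (linZeros S) := by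
  obtain ⟨e⟩ := nonempty_quotient_span_linForm_algEquiv S
  rw [ringKrullDim_eq_of_ringEquiv e.toRingEquiv, ringKrullDim_mvPolynomial_fin]

/-- Enlarging the zero space by one vector gives a strictly smaller prime, strict because the
quotients have different dimensions. Iteration builds a chain of primes of length the codimension.
-/
theorem le_height_span_linForm (S : Set (Fin n → F)) (k : ℕ)
    (hk : k + Module.finrank F (linZeros S) = n) :
    (k : ℕ∞) ≤ (Ideal.span (linForm '' S)).height := by
  induction k generalizing S with
  | zero => simp
  | succ k ih =>
    obtain ⟨x, hx⟩ : ∃ x, x ∉ linZeros S := by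
      by_contra! h
      have : linZeros S = ⊤ := eq_top_iff.mpr fun x _ => h x
      rw [this, finrank_top, Module.finrank_fin_fun] at hk
      omega
    let Z := linZeros S ⊔ Submodule.span F {x}
    let S' : Set (Fin n → F) := {a | ∀ y ∈ Z, a ⬝ᵥ y = 0}
    have hS' : linZeros S' = Z := by
      refine le_antisymm (fun y hy => ?_) fun y hy a ha => ha y hy
      by_contra hn
      obtain ⟨f, hf0, hf⟩ := Submodule.exists_le_ker_of_notMem hn
      have key : ∀ v, (fun j => f (Pi.single j 1)) ⬝ᵥ v = f v := fun v => by
        conv_rhs => rw [pi_eq_sum_univ' v]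
        simp [map_sum, dotProduct, mul_comm]
      exact hf0 (by rw [← key, hy _ fun z hz => (key z).trans (hf hz)])
    have hd : Module.finrank F Z = Module.finrank F (linZeros S) + 1 :=
      Submodule.finrank_sup_span_singleton hx
    have h1 := ih S' (by rw [hS', hd]; omega)
    have := isPrime_span_linForm S
    have := isPrime_span_linForm S'
    have hlt : Ideal.span (linForm '' S') < Ideal.span (linForm '' S) := by
      refine lt_of_le_of_ne (Ideal.span_le.mpr ?_) fun he => ?_
      · rintro _ ⟨a, ha, rfl⟩
        exact linForm_mem_span_of_forall_linZeros fun y hy => ha y (Submodule.mem_sup_left hy)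
      · have h2 := ringKrullDim_quotient_span_linForm S
        rw [← he, ringKrullDim_quotient_span_linForm S', hS', hd] at h2
        have h3 : Module.finrank F (linZeros S) + 1 = Module.finrank F (linZeros S) := by
          exact_mod_cast h2
        omega
    calc ((k + 1 : ℕ) : ℕ∞) = k + 1 := by simp
      _ ≤ (Ideal.span (linForm '' S')).height + 1 := by gcongr
      _ ≤ _ := Ideal.height_add_one_le_of_lt_of_isPrime hlt

/-- The upper bound is height plus coheight at most `n`, where the coheight is the dimension of the
quotient; the lower bound is the explicit chain. -/
theorem height_span_linForm_add_finrank (S : Set (Fin n → F)) :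
    (Ideal.span (linForm '' S)).height + Module.finrank F (linZeros S) = n := by
  have hle : Module.finrank F (linZeros S) ≤ n := by
    simpa using (linZeros S).finrank_le
  obtain ⟨k, hk⟩ := Nat.exists_eq_add_of_le' hle
  refine le_antisymm ?_ ?_
  · have := isPrime_span_linForm S
    let p : PrimeSpectrum (MvPolynomial (Fin n) F) := ⟨Ideal.span (linForm '' S), this⟩
    have h1 : ((Order.height p + Order.coheight p : ℕ∞) : WithBot ℕ∞) ≤ n := by
      rw [← ringKrullDim_mvPolynomial_fin (F := F) n, ringKrullDim,
        Order.krullDim_eq_iSup_height_add_coheight_of_nonempty]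
      exact WithBot.coe_le_coe.mpr (le_iSup (fun q => Order.height q + Order.coheight q) p)
    have h2 : Order.coheight p = Module.finrank F (linZeros S) := by
      have h3 := ringKrullDim_quotient_span_linForm S
      rw [ringKrullDim_quotient] at h3
      have h4 := Order.coheight_eq_krullDim_Ici p
      have h5 : Set.Ici p = PrimeSpectrum.zeroLocus (Ideal.span (linForm '' S) :
        Set (MvPolynomial (Fin n) F)) := rfl
      rw [h5, h3] at h4
      exact_mod_cast h4
    rw [h2, ← PrimeSpectrum.height_eq_orderHeight] at h1
    exact_mod_cast h1
  · calc (n : ℕ∞) = (k : ℕ∞) + Module.finrank F (linZeros S) := by exact_mod_cast hk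
      _ ≤ _ := by gcongr; exact le_height_span_linForm S k hk.symm

end LinearForms

/-- A ring which is a quotient of a polynomial ring over `A` by linear forms, up to thickening,
has dimension `d` if the linear forms have a `d`-dimensional zero space at all of its points. -/
theorem ringKrullDim_eq_of_forall_finrank_linZeros {n d : ℕ} {A C : Type u} [CommRing A] [CommRing C]
    (Λ : Set (Fin n → A)) (f : MvPolynomial (Fin n) A →+* C) (hf : Function.Surjective f)
    (hΛ : ∀ a ∈ Λ, f (linForm a) = 0)
    (H : ∀ p : PrimeSpectrum C, ∃ (κ : Type u) (_ : Field κ) (θ : A →+* κ),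
      Function.Surjective θ ∧ (∀ a, θ a = 0 → f (MvPolynomial.C a) ∈ p.asIdeal) ∧
      Module.finrank κ (linZeros ((θ ∘ ·) '' Λ)) = d)
    {κ : Type u} [Field κ] (θ : A →+* κ)
    (g : C →+* MvPolynomial (Fin n) κ ⧸ Ideal.span (linForm '' ((θ ∘ ·) '' Λ)))
    (hg : Function.Surjective g) (hd : Module.finrank κ (linZeros ((θ ∘ ·) '' Λ)) = d) :
    ringKrullDim C = d := by
  apply le_antisymm
  · rw [ringKrullDim, Order.krullDim_eq_iSup_coheight]
    refine iSup_le fun p => ?_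
    obtain ⟨κ, _, θ, hθ, hker, hd⟩ := H p
    have hp : Set.Ici p = PrimeSpectrum.zeroLocus (p.asIdeal : Set C) := rfl
    rw [Order.coheight_eq_krullDim_Ici, hp, ← ringKrullDim_quotient, ← hd,
      ← ringKrullDim_quotient_span_linForm]
    have hmk : ∀ a b : A, θ a = θ b → Ideal.Quotient.mk p.asIdeal (f (MvPolynomial.C a)) =
        Ideal.Quotient.mk p.asIdeal (f (MvPolynomial.C b)) := fun a b hab => by
      rw [Ideal.Quotient.mk_eq_mk_iff_sub_mem, ← map_sub, ← map_sub]
      exact hker _ (by rw [map_sub, hab, sub_self])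
    let ψ : κ →+* C ⧸ p.asIdeal := RingHom.liftOfSurjective θ hθ
      ⟨((Ideal.Quotient.mk p.asIdeal).comp f).comp MvPolynomial.C, fun a ha => by
        simpa using hmk a 0 (by simpa using ha)⟩
    have hψ : ∀ a, ψ (θ a) = Ideal.Quotient.mk p.asIdeal (f (MvPolynomial.C a)) := fun a =>
      RingHom.liftOfRightInverse_comp_apply _ _ _ _ _
    let Ψ : MvPolynomial (Fin n) κ →+* C ⧸ p.asIdeal :=
      MvPolynomial.eval₂Hom ψ fun i => Ideal.Quotient.mk p.asIdeal (f (MvPolynomial.X i))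
    have hΨ : Ψ.comp (MvPolynomial.map θ) = (Ideal.Quotient.mk p.asIdeal).comp f := by
      ext <;> simp [Ψ, hψ]
    have hΨs : Function.Surjective Ψ := by
      have : Function.Surjective (Ψ.comp (MvPolynomial.map θ)) := by
        rw [hΨ]
        exact Ideal.Quotient.mk_surjective.comp hf
      exact Function.Surjective.of_comp this
    have hΨ0 : ∀ x ∈ Ideal.span (linForm '' ((θ ∘ ·) '' Λ)), Ψ x = 0 := by
      refine fun x hx => (Ideal.span_le (I := RingHom.ker Ψ)).mpr ?_ hx
      rintro _ ⟨_, ⟨a, ha, rfl⟩, rfl⟩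
      have h1 : linForm (θ ∘ a) = MvPolynomial.map θ (linForm a) := by simp [linForm]
      change Ψ (linForm (θ ∘ a)) = 0
      rw [h1, ← RingHom.comp_apply, hΨ, RingHom.comp_apply, hΛ a ha, map_zero]
    exact ringKrullDim_le_of_surjective (Ideal.Quotient.lift _ Ψ hΨ0)
      (Ideal.Quotient.lift_surjective_of_surjective _ hΨ0 hΨs)
  · rw [← hd, ← ringKrullDim_quotient_span_linForm]
    exact ringKrullDim_le_of_surjective g hg

/-! ### Galois invariant norm and prime of an algebraic extension. -/

section LocalField

variable (K : Type*) [Field K] [ValuativeRel K] [TopologicalSpace K]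
  [IsNonarchimedeanLocalField K]

/-- A non-archimedean local field has a Galois invariant extension of its absolute value to any
algebraic extension. -/
theorem exists_invariant_norm (L : Type*) [Field L] [Algebra K L] [Algebra.IsAlgebraic K L] :
    ∃ μ : L → ℝ, μ 0 = 0 ∧ μ 1 = 1 ∧ (∀ x y, μ (x * y) = μ x * μ y) ∧
      (∀ x y, μ (x + y) ≤ max (μ x) (μ y)) ∧ (∀ (τ : L ≃ₐ[K] L) x, μ (τ x) = μ x) ∧
      (∀ x, 0 ≤ μ x) ∧ (∀ x, IsIntegral 𝒪[K] x → μ x ≤ 1) ∧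
      ∀ a ∈ 𝓂[K], μ (algebraMap 𝒪[K] L a) < 1 := by
  let := IsTopologicalAddGroup.rightUniformSpace K
  have := isUniformAddGroup_of_addCommGroup (G := K)
  -- A real-valued rank one structure turns `K` into a complete normed field, over which the
  -- spectral norm is multiplicative and Galois invariant.
  let : (Valued.v (R := K) (Γ₀ := ValuativeRel.ValueGroupWithZero K)).RankOne :=
    { hom' := ValuativeRel.IsRankLeOne.nonempty.some.emb (R := K).comp
        MonoidWithZeroHom.ValueGroup₀.embedding
      strictMono' := ValuativeRel.IsRankLeOne.nonempty.some.strictMono.comp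
        MonoidWithZeroHom.ValueGroup₀.embedding_strictMono }
  let : NontriviallyNormedField K :=
    Valued.toNontriviallyNormedField K (ValuativeRel.ValueGroupWithZero K)
  have hcomplete : CompleteSpace K := inferInstance
  have hle : ∀ a : K, ‖a‖ ≤ 1 ↔ ValuativeRel.valuation K a ≤ 1 := fun a =>
    Valued.toNormedField.norm_le_one_iff
  have hlt : ∀ a : K, ‖a‖ < 1 ↔ ValuativeRel.valuation K a < 1 := fun a =>
    Valued.toNormedField.norm_lt_one_iff
  refine ⟨spectralNorm K L, spectralNorm_zero, spectralNorm_one, spectralAlgNorm_mul,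
    isNonarchimedean_spectralNorm, fun τ x => (spectralNorm_eq_of_equiv τ x).symm,
    spectralNorm_nonneg, fun x hx => ?_, fun a ha => ?_⟩
  · rw [spectralNorm, spectralValue_le_one_iff (minpoly.monic hx.tower_top)]
    intro i
    rw [minpoly.isIntegrallyClosed_eq_field_fractions' K hx, Polynomial.coeff_map]
    exact (hle _).mpr ((minpoly 𝒪[K] x).coeff i).2
  · rw [IsScalarTower.algebraMap_apply 𝒪[K] K L, spectralNorm_extends, hlt]
    exact Valuation.Integer.not_isUnit_iff_valuation_lt_one.mp ha

/-- The ring of integers of an algebraic extension of a local field has a Galois invariant prime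
above the maximal ideal. -/
theorem exists_invariant_prime (L : Type*) [Field L] [Algebra K L] [Algebra.IsAlgebraic K L] :
    ∃ 𝔫 : Ideal (integralClosure 𝒪[K] L), 𝔫.IsPrime ∧
      (∀ (τ : L ≃ₐ[K] L) (x y : integralClosure 𝒪[K] L), (y : L) = τ x → x ∈ 𝔫 → y ∈ 𝔫) ∧
      ∀ a ∈ 𝓂[K], algebraMap 𝒪[K] (integralClosure 𝒪[K] L) a ∈ 𝔫 := by
  obtain ⟨μ, h0, h1, hmul, hadd, hτ, hnn, hint, hm⟩ := exists_invariant_norm K L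
  -- The open unit ball of the invariant norm.
  let 𝔫 : Ideal (integralClosure 𝒪[K] L) :=
    { carrier := {x | μ x < 1}
      add_mem' := fun {x y} hx hy => (hadd _ _).trans_lt (max_lt hx hy)
      zero_mem' := by simp [h0]
      smul_mem' := fun c x hx => by
        change μ (c * x) < 1
        rw [hmul]
        exact (mul_le_of_le_one_left (hnn _) (hint _ c.2)).trans_lt hx }
  refine ⟨𝔫, ⟨fun h => ?_, fun {x y} hxy => ?_⟩, fun τ x y hxy hx => ?_, fun a ha => hm a ha⟩
  · have : μ ((1 : integralClosure 𝒪[K] L) : L) < 1 := (Ideal.eq_top_iff_one 𝔫).mp h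
    rw [OneMemClass.coe_one, h1] at this
    exact lt_irrefl _ this
  · by_contra! h
    have hx : μ x = 1 := le_antisymm (hint _ x.2) (not_lt.mp h.1)
    have hy : μ y = 1 := le_antisymm (hint _ y.2) (not_lt.mp h.2)
    have hxy' : μ (x * y) < 1 := hxy
    rw [hmul, hx, hy, one_mul] at hxy'
    exact lt_irrefl _ hxy'
  · change μ y < 1
    rw [hxy, hτ]
    exact hx

end LocalField

/-! ### Unramified algebras and roots of unity. -/

/-- Two homomorphisms from an unramified algebra into a domain which agree modulo a proper ideal are
equal. -/
theorem Algebra.FormallyUnramified.algHom_eq_of_forall_sub_mem {R S B : Type*} [CommRing R]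
    [CommRing S] [CommRing B] [Algebra R S] [Algebra R B] [Algebra.EssFiniteType R S]
    [Algebra.FormallyUnramified R S] [IsDomain B] (𝔫 : Ideal B) (h𝔫 : 𝔫 ≠ ⊤) (f g : S →ₐ[R] B)
    (h : ∀ s, g s - f s ∈ 𝔫) : f = g := by
  -- `t` plays the role of a separability idempotent: it multiplies to `1` and kills the differences
  -- of the two embeddings of `S`. Its image under `f ⊗ g` is congruent to `1` modulo `𝔫`, hence
  -- nonzero, and can be cancelled in the domain `B`.
  obtain ⟨t, ht, ht1⟩ := (Algebra.FormallyUnramified.iff_exists_tensorProduct (R := R) (S := S)).mp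
    inferInstance
  let Φ : S ⊗[R] S →ₐ[R] B := Algebra.TensorProduct.lift f g fun _ _ => Commute.all _ _
  have h1 : ∀ x : S ⊗[R] S, Φ x - f (Algebra.TensorProduct.lmul' R x) ∈ 𝔫 := fun x => by
    induction x with
    | zero => simp
    | add x y hx hy =>
      rw [map_add, map_add, map_add, add_sub_add_comm]
      exact 𝔫.add_mem hx hy
    | tmul a b =>
      simp only [Φ, Algebra.TensorProduct.lift_tmul, Algebra.TensorProduct.lmul'_apply_tmul, map_mul, ← mul_sub]
      exact 𝔫.mul_mem_left _ (h b)
  have h2 : Φ t ≠ 0 := fun h0 => by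
    have := h1 t
    rw [h0, ht1, map_one, zero_sub, neg_mem_iff] at this
    exact h𝔫 ((Ideal.eq_top_iff_one _).mpr this)
  ext s
  have h3 := congrArg Φ (ht s)
  rw [map_mul, map_zero, map_sub] at h3
  have h4 := (mul_eq_zero.mp h3).resolve_right h2
  simp only [Φ, Algebra.TensorProduct.lift_tmul, map_one, one_mul, mul_one] at h4
  first
  | exact (sub_eq_zero.mp h4)
  | exact (sub_eq_zero.mp h4).symm

section RootsOfUnity

/-- The ring of integers of an extension generated by a root of unity whose order is invertible is
unramified. -/
theorem formallyUnramified_integralClosure_adjoin_of_pow_eq_one {R K L : Type*} [CommRing R]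
    [IsDomain R] [IsIntegrallyClosed R] [Field K] [Algebra R K] [IsFractionRing R K] [Field L]
    [Algebra K L] [Algebra R L] [IsScalarTower R K L] [Algebra.IsSeparable K L]
    {N : ℕ} (hN : IsUnit (N : R)) (hN0 : N ≠ 0) (ζ : L) (hζ : ζ ^ N = 1)
    (htop : IntermediateField.adjoin K {ζ} = ⊤) :
    Algebra.FormallyUnramified R (integralClosure R L) := by
  have hint : IsIntegral R ζ := IsIntegral.of_pow (Nat.pos_of_ne_zero hN0) (hζ ▸ isIntegral_one)
  have hintK : IsIntegral K ζ := hint.tower_top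
  have : Module.IsTorsionFree R L := by
    rw [Module.isTorsionFree_iff_algebraMap_injective, IsScalarTower.algebraMap_eq R K L]
    exact (algebraMap K L).injective.comp (IsFractionRing.injective R K)
  have hζ0 : ζ ≠ 0 := fun h => by simp [h, hN0] at hζ
  let B : PowerBasis K L := PowerBasis.ofAdjoinEqTop' hintK <| by
    rw [← IntermediateField.adjoin_simple_toSubalgebra_of_isAlgebraic hintK.isAlgebraic, htop,
      IntermediateField.top_toSubalgebra]
  have hB : B.gen = ζ := PowerBasis.ofAdjoinEqTop'_gen _ _
  have hfin : FiniteDimensional K L := B.finite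
  obtain ⟨q, hq⟩ : minpoly R ζ ∣ Polynomial.X ^ N - 1 :=
    minpoly.isIntegrallyClosed_dvd hint (by simp [hζ])
  -- Differentiating `X ^ N - 1 = (minpoly) * q` at `ζ` and multiplying by `ζ` gives `N`. Hence the
  -- different element `f'(ζ)` has unit norm.
  have hder : Polynomial.aeval ζ (minpoly K ζ).derivative * (Polynomial.aeval ζ q * ζ) =
      algebraMap R L N := by
    have h1 := congrArg (fun f => Polynomial.aeval ζ (Polynomial.derivative f)) hq
    simp only [Polynomial.derivative_X_pow, Polynomial.derivative_one,
      Polynomial.derivative_mul, map_sub, map_add, map_mul, minpoly.aeval, zero_mul, add_zero,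
      sub_zero, map_pow, Polynomial.aeval_X, Polynomial.aeval_C] at h1
    rw [minpoly.isIntegrallyClosed_eq_field_fractions' K hint, Polynomial.derivative_map,
      Polynomial.aeval_map_algebraMap, ← mul_assoc, ← h1, mul_assoc, ← pow_succ,
      Nat.sub_add_cancel (Nat.pos_of_ne_zero hN0), hζ, mul_one]
  have hnorm : ∀ x : L, IsIntegral R x → ∃ r : R, algebraMap R K r = Algebra.norm K x :=
    fun x hx => IsIntegrallyClosed.isIntegral_iff.mp (Algebra.isIntegral_norm K hx)
  have hadj : ∀ p : Polynomial R, IsIntegral R (Polynomial.aeval ζ p) := fun p =>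
    by
    have := (Polynomial.aeval (⟨ζ, hint⟩ : integralClosure R L) p).2
    rwa [← Subalgebra.coe_val, ← Polynomial.aeval_algHom_apply] at this
  obtain ⟨a, ha⟩ := hnorm (Polynomial.aeval ζ (minpoly K ζ).derivative) <| by
    rw [minpoly.isIntegrallyClosed_eq_field_fractions' K hint, Polynomial.derivative_map,
      Polynomial.aeval_map_algebraMap]
    exact hadj _
  obtain ⟨c, hc⟩ := hnorm (Polynomial.aeval ζ q * ζ) ((hadj q).mul hint)
  have hau : IsUnit a := by
    have h1 := congrArg (Algebra.norm K) hder
    rw [map_mul, ← ha, ← hc, IsScalarTower.algebraMap_apply R K L, Algebra.norm_algebraMap,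
      ← map_mul, ← map_pow] at h1
    exact isUnit_of_mul_isUnit_left (IsFractionRing.injective R K h1 ▸ hN.pow _)
  -- The discriminant of the power basis is, up to sign, the norm of `f'(ζ)`, a unit, so every
  -- integral element lies in `R[ζ]`.
  have hmem : ∀ z : L, IsIntegral R z → z ∈ Algebra.adjoin R {ζ} := fun z hz => by
    have h1 := Algebra.discr_mul_isIntegral_mem_adjoin K (B := B) (by rwa [hB]) hz
    rw [Algebra.discr_powerBasis_eq_norm, hB, ← ha] at h1
    obtain ⟨u, rfl⟩ := hau
    have h2 := Subalgebra.smul_mem _ h1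
      ((-1) ^ (Module.finrank K L * (Module.finrank K L - 1) / 2) * ((u⁻¹ : Rˣ) : R))
    rw [← algebraMap_smul K, smul_smul] at h2
    have h3 : algebraMap R K ((u⁻¹ : Rˣ) : R) * algebraMap R K u = 1 := by
      rw [← map_mul, Units.inv_mul, map_one]
    convert h2
    rw [map_mul, map_pow, map_neg, map_one, mul_mul_mul_comm, h3, mul_one, ← pow_add, ← two_mul,
      pow_mul]
    simp
  set ζ' : integralClosure R L := ⟨ζ, hint⟩ with hζ'
  have hζN : ζ' ^ N = 1 := Subtype.ext hζ
  -- From `ζ ^ N = 1` follows `N ζ ^ (N - 1) dζ = 0` with invertible coefficient; as `dζ` generates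
  -- the differentials, they all vanish.
  have hD : KaehlerDifferential.D R (integralClosure R L) ζ' = 0 := by
    have h1 := congrArg (KaehlerDifferential.D R (integralClosure R L)) hζN
    rw [Derivation.leibniz_pow, Derivation.map_one_eq_zero] at h1
    have h2 : IsUnit ((N : integralClosure R L) * ζ' ^ (N - 1)) := by
      refine IsUnit.mul (by simpa using hN.map (algebraMap R (integralClosure R L))) ?_
      exact IsUnit.pow _ (IsUnit.of_pow_eq_one hζN hN0)
    rw [← Nat.cast_smul_eq_nsmul (integralClosure R L), smul_smul] at h1
    exact (h2.smul_eq_zero).mp h1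
  rw [Algebra.formallyUnramified_iff,
    ← Submodule.subsingleton_iff (integralClosure R L), ← subsingleton_iff_bot_eq_top, eq_comm,
    ← KaehlerDifferential.span_range_derivation, Submodule.span_eq_bot]
  rintro _ ⟨z, rfl⟩
  obtain ⟨p, hp⟩ := (Algebra.adjoin_singleton_eq_range_aeval R ζ ▸ hmem z z.2 :
    (z : L) ∈ (Polynomial.aeval ζ).range)
  have hz : z = Polynomial.aeval ζ' p := by
    ext
    rw [← Subalgebra.coe_val, ← Polynomial.aeval_algHom_apply]
    exact hp.symm
  rw [hz, Derivation.map_aeval, hD, smul_zero]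

/-- Roots of unity of order invertible in the ring of integers lie in the maximal unramified
extension. -/
theorem mem_maxUnramified_of_pow_eq_one (K : Type*) [Field K] [ValuativeRel K] {N : ℕ}
    (hN : IsUnit (N : 𝒪[K])) (hN0 : N ≠ 0) (ζ : SeparableClosure K) (hζ : ζ ^ N = 1) :
    ζ ∈ maxUnramified K := by
  have hint : IsIntegral K ζ := IsIntegral.of_pow (Nat.pos_of_ne_zero hN0) (hζ ▸ isIntegral_one)
  have hle : IntermediateField.adjoin K {ζ} ≤ maxUnramified K := by
    refine le_sSup ⟨IntermediateField.adjoin.finiteDimensional hint, ?_⟩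
    refine formallyUnramified_integralClosure_adjoin_of_pow_eq_one (K := K) hN hN0
      (IntermediateField.AdjoinSimple.gen K ζ) (Subtype.ext ?_) ?_
    · simpa using hζ
    · apply IntermediateField.lift_injective
      rw [IntermediateField.lift_adjoin_simple, IntermediateField.lift_top]
      rfl
  exact hle (IntermediateField.mem_adjoin_simple_self K ζ)

end RootsOfUnity

/-! ### Conjugacy of the points of a `G`-étale algebra. -/

section Embeddings

/-- Two homomorphisms into a normal extension with the same kernel are conjugate. -/
theorem exists_algEquiv_of_ker_eq {F Ω A : Type*} [Field F] [Field Ω] [Algebra F Ω] [Normal F Ω]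
    [CommRing A] [Algebra F A] (f g : A →ₐ[F] Ω) (h : RingHom.ker f = RingHom.ker g) :
    ∃ τ : Ω ≃ₐ[F] Ω, ∀ a, τ (f a) = g a := by
  -- A subalgebra of an algebraic field extension is a field. Equal kernels make `g` factor through
  -- it, and normality extends the resulting embedding.
  let L : IntermediateField F Ω := f.range.toIntermediateField fun x hx => by
    exact f.range.inv_mem_of_algebraic (x := ⟨x, hx⟩) (Algebra.IsAlgebraic.isAlgebraic x)
  let e : A →ₐ[F] L := f.codRestrict f.range fun a => ⟨a, rfl⟩
  have he : Function.Surjective e := fun ⟨y, a, ha⟩ => ⟨a, Subtype.ext ha⟩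
  have hker : RingHom.ker e = RingHom.ker f := by
    ext a
    simp only [RingHom.mem_ker]
    exact Subtype.ext_iff
  let φ : L →ₐ[F] Ω := AlgHom.liftOfSurjective e he g (fun a ha => by
    have h1 : a ∈ RingHom.ker e := ha
    rwa [hker, h] at h1)
  have hφ : ∀ a, φ (e a) = g a := fun a => AlgHom.liftOfSurjective_apply ..
  refine ⟨AlgEquiv.ofBijective (φ.liftNormal Ω) (AlgHom.normal_bijective F Ω Ω _), fun a => ?_⟩
  have := AlgHom.liftNormal_commutes φ Ω (e a)
  rw [hφ] at this
  exact this

/-- Any two points of a `G`-étale algebra with values in a domain are conjugate under `G`. -/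
theorem exists_eq_comp_op_smul {K G M Ω : Type*} [Field K] [Infinite K] [Group G] [Finite G]
    [CommRing M] [Algebra K M] [MulSemiringAction Gᵐᵒᵖ M] [SMulCommClass Gᵐᵒᵖ K M]
    [IsGEtale K G M] [Field Ω] [Algebra K Ω] (χ χ' : M →ₐ[K] Ω) :
    ∃ g : G, ∀ m, χ' m = χ (op g • m) := by
  have : Finite Gᵐᵒᵖ := Finite.of_equiv G MulOpposite.opEquiv
  cases nonempty_fintype Gᵐᵒᵖ
  by_contra! H
  -- If no conjugate of `χ` equals `χ'`, these equalizers are proper subspaces. Over an infinite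
  -- field finitely many of them do not cover `M`, so one `m` separates `χ'` from every conjugate,
  -- although `χ' m` is a root of `∏ (X - χ (γ • m))`.
  let S : Gᵐᵒᵖ → Submodule K M := fun γ => LinearMap.ker
    (χ'.toLinearMap - χ.toLinearMap ∘ₗ (MulSemiringAction.toAlgHom K M γ).toLinearMap)
  have hS : ∀ γ m, m ∈ S γ ↔ χ' m = χ (γ • m) := fun γ m => by
    simp [S, LinearMap.mem_ker, sub_eq_zero]
  have hex : ∃ m, ∀ γ, m ∉ S γ := by
    by_contra! h
    obtain ⟨γ, hγ⟩ := Subspace.exists_eq_top_of_iUnion_eq_univ (p := S) (Set.eq_univ_of_forall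
      fun m => Set.mem_iUnion.mpr (h m))
    obtain ⟨m, hm⟩ := H γ.unop
    exact hm ((hS γ m).mp (hγ ▸ Submodule.mem_top))
  obtain ⟨m, hm⟩ := hex
  have hinv : ∀ i, ∃ k : K, algebraMap K M k = (MulSemiringAction.charpoly Gᵐᵒᵖ m).coeff i :=
    fun i => (IsGEtale.invariant_iff (K := K) (G := G) _).mp fun g =>
      MulSemiringAction.smul_coeff_charpoly m i (op g)
  have h1 : (MulSemiringAction.charpoly Gᵐᵒᵖ m).map (χ : M →+* Ω) =
      (MulSemiringAction.charpoly Gᵐᵒᵖ m).map (χ' : M →+* Ω) := by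
    ext i
    obtain ⟨k, hk⟩ := hinv i
    rw [Polynomial.coeff_map, Polynomial.coeff_map, ← hk]
    simp
  have h2 : ((MulSemiringAction.charpoly Gᵐᵒᵖ m).map (χ' : M →+* Ω)).eval (χ' m) = 0 := by
    have := Polynomial.eval_map_apply (χ' : M →+* Ω) m (p := MulSemiringAction.charpoly Gᵐᵒᵖ m)
    rw [MulSemiringAction.eval_charpoly, map_zero] at this
    exact this
  rw [← h1, MulSemiringAction.charpoly_eq, Polynomial.map_prod, Polynomial.eval_prod,
    Finset.prod_eq_zero_iff] at h2
  obtain ⟨γ, _, hγ⟩ := h2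
  exact hm γ ((hS γ m).mpr (by simpa [sub_eq_zero] using hγ))

/-- The points of a `G`-étale algebra with values in a separably closed field form a torsor. -/
theorem op_smul_injective_of_isSepClosed {K M Ω : Type u} {G : Type*} [Field K] [Infinite K]
    [Group G] [Finite G] [CommRing M] [Algebra K M] [MulSemiringAction Gᵐᵒᵖ M]
    [SMulCommClass Gᵐᵒᵖ K M] [IsGEtale K G M] [Field Ω] [Algebra K Ω] [IsSepClosed Ω]
    (χ : M →ₐ[K] Ω) (g g' : G) (h : ∀ m, χ (op g • m) = χ (op g' • m)) : g = g' := by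
  have : Algebra.Etale K M := IsGEtale.etale G
  have : Module.Finite K M := IsGEtale.finite G
  -- `Ω ⊗ M` splits into `#G` copies of `Ω`, giving `#G` distinct points, each a conjugate of `χ`.
  -- Choosing conjugating elements is therefore a bijection with `G`.
  let Φ := Algebra.FormallyEtale.equivPiOfIsSepClosed Ω (Ω ⊗[K] M)
  have : IsArtinianRing (Ω ⊗[K] M) := isArtinian_of_tower Ω inferInstance
  cases nonempty_fintype G
  cases nonempty_fintype (PrimeSpectrum (Ω ⊗[K] M))
  have hcard : Fintype.card (PrimeSpectrum (Ω ⊗[K] M)) = Fintype.card G := by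
    rw [← Module.finrank_fintype_fun_eq_card Ω, ← Φ.toLinearEquiv.finrank_eq,
      Module.finrank_baseChange, IsGEtale.finrank_eq (G := G), Nat.card_eq_fintype_card]
  let χs : PrimeSpectrum (Ω ⊗[K] M) → M →ₐ[K] Ω := fun x =>
    (((Pi.evalAlgHom Ω (fun _ => Ω) x).comp Φ.toAlgHom).restrictScalars K).comp
      Algebra.TensorProduct.includeRight
  have hχs : Function.Injective χs := fun x y hxy => by
    classical
    have h1 : (Pi.evalAlgHom Ω (fun _ => Ω) x).comp Φ.toAlgHom =
        (Pi.evalAlgHom Ω (fun _ => Ω) y).comp Φ.toAlgHom := by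
      ext m
      exact DFunLike.congr_fun hxy m
    obtain ⟨t, ht⟩ := Φ.surjective (Pi.single x 1)
    have h2 : Φ t x = Φ t y := DFunLike.congr_fun h1 t
    by_contra hne
    rw [ht, Pi.single_eq_same, Pi.single_eq_of_ne (Ne.symm hne)] at h2
    exact one_ne_zero h2
  choose γ hγ using fun x => exists_eq_comp_op_smul (G := G) χ (χs x)
  have hγi : Function.Injective γ := fun x y hxy => hχs <| by
    ext m
    rw [hγ, hγ, hxy]
  have hγb := (Fintype.bijective_iff_injective_and_card γ).mpr ⟨hγi, hcard⟩
  obtain ⟨x, rfl⟩ := hγb.2 g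
  obtain ⟨y, rfl⟩ := hγb.2 g'
  rw [show x = y from hχs <| by ext m; rw [hγ, hγ, h]]

end Embeddings

/-! ### Geometric components and their stabilizers. -/

section GeometricPoint

variable {K U Ω M : Type u} [Field K] [Field U] [Field Ω] [Algebra K U] [Algebra K Ω] [Algebra U Ω]
  [IsScalarTower K U Ω] [CommRing M] [Algebra K M]

variable (U) in
/-- The `U`-algebra homomorphism `M ⊗ U → Ω` given by a `K`-algebra homomorphism `M → Ω`. -/
def geomPoint (χ : M →ₐ[K] Ω) : M ⊗[K] U →ₐ[K] Ω :=
  Algebra.TensorProduct.lift χ (IsScalarTower.toAlgHom K U Ω) fun _ _ => Commute.all _ _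

theorem isArtinianRing_tensorProduct_right [Module.Finite K M] : IsArtinianRing (M ⊗[K] U) := by
  have : IsArtinianRing (U ⊗[K] M) := isArtinian_of_tower U inferInstance
  exact (Algebra.TensorProduct.comm K M U).symm.toRingEquiv.surjective.isArtinianRing

/-- Every point of `M ⊗ U` comes from a point of `M` with values in the separable closure. -/
theorem exists_geomPoint [IsSepClosed Ω] [Algebra.Etale K M] [Module.Finite K M]
    (z : PrimeSpectrum (M ⊗[K] U)) :
    ∃ χ : M →ₐ[K] Ω, ∀ t, t ∈ z.asIdeal ↔ geomPoint U χ t = 0 := by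
  let c := Algebra.TensorProduct.comm K M U
  have : IsArtinianRing (U ⊗[K] M) := isArtinian_of_tower U inferInstance
  let z' : Ideal (U ⊗[K] M) := z.asIdeal.comap c.symm
  have hp : z'.IsPrime := Ideal.comap_isPrime _ _
  have hm : z'.IsMaximal := IsArtinianRing.isMaximal_of_isPrime z'
  let := Ideal.Quotient.field z'
  have : Algebra.FormallyUnramified U ((U ⊗[K] M) ⧸ z') :=
    Algebra.FormallyUnramified.of_surjective (Ideal.Quotient.mkₐ U z') Ideal.Quotient.mk_surjective
  have : Algebra.IsSeparable U ((U ⊗[K] M) ⧸ z') := Algebra.FormallyUnramified.isSeparable _ _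
  -- The residue field at the point is separable over `U` because `M` is étale, so it embeds into
  -- `Ω`.
  let ψ : ((U ⊗[K] M) ⧸ z') →ₐ[U] Ω := IsSepClosed.lift
  let Ψ := ψ.comp (Ideal.Quotient.mkₐ U z')
  refine ⟨(Ψ.restrictScalars K).comp Algebra.TensorProduct.includeRight, fun t => ?_⟩
  have hΨ : geomPoint U ((Ψ.restrictScalars K).comp Algebra.TensorProduct.includeRight) =
      (Ψ.restrictScalars K).comp c.toAlgHom := by
    ext m
    · simp [geomPoint, c]
    · simp only [geomPoint, c]
      simpa [Algebra.TensorProduct.algebraMap_apply] using (Ψ.commutes m).symm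
  rw [hΨ]
  change _ ↔ ψ (Ideal.Quotient.mk z' (c t)) = 0
  rw [map_eq_zero_iff ψ ψ.injective, Ideal.Quotient.eq_zero_iff_mem, Ideal.mem_comap]
  simp

/-- Two points with values in a normal extension of `U` have the same image in `Spec (M ⊗ U)` if and
only if they are conjugate over `U`. -/
theorem forall_geomPoint_eq_zero_iff [Normal U Ω] (χ χ' : M →ₐ[K] Ω) :
    (∀ t, geomPoint U χ' t = 0 ↔ geomPoint U χ t = 0) ↔
      ∃ τ : Ω ≃ₐ[U] Ω, ∀ m, τ (χ m) = χ' m := by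
  let P : (M →ₐ[K] Ω) → U ⊗[K] M →ₐ[U] Ω := fun χ =>
    Algebra.TensorProduct.lift (Algebra.ofId _ _) χ fun _ _ => Commute.all _ _
  have hP : ∀ χ t, P χ (Algebra.TensorProduct.comm K M U t) = geomPoint U χ t := fun χ t => by
    induction t with
    | zero => simp
    | add x y hx hy => rw [map_add, map_add, map_add, hx, hy]
    | tmul a b =>
      simp only [P, geomPoint, Algebra.TensorProduct.comm_tmul, Algebra.TensorProduct.lift_tmul,
        mul_comm (χ a)]
      rfl
  constructor
  · intro h
    obtain ⟨τ, hτ⟩ := exists_algEquiv_of_ker_eq (P χ) (P χ') <| by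
      ext t
      obtain ⟨t, rfl⟩ := (Algebra.TensorProduct.comm K M U).surjective t
      simp only [RingHom.mem_ker, hP, h]
    refine ⟨τ, fun m => ?_⟩
    have := hτ (1 ⊗ₜ m)
    simpa [P] using this
  · rintro ⟨τ, hτ⟩ t
    have h3 : P χ' = (τ : Ω →ₐ[U] Ω).comp (P χ) := by
      ext m
      simp [P, hτ]
    rw [← hP, ← hP, h3]
    simp

end GeometricPoint

section GeomStabilizer

variable {K M : Type u} [Field K] [ValuativeRel K] [CommRing M] [Algebra K M] [Module.Finite K M]
  {G : Type*} [Group G] [MulSemiringAction Gᵐᵒᵖ M] [SMulCommClass Gᵐᵒᵖ K M]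

theorem connectedComponent_primeSpectrum_eq_singleton {R : Type*} [CommRing R] [IsArtinianRing R]
    (z : PrimeSpectrum R) : connectedComponent z = {z} :=
  connectedComponent_eq_singleton z

/-- The ring `M ⊗ K^ur` is artinian, so its spectrum is discrete and components are points. -/
theorem mem_geomStabilizer_iff_eq {g : G} {z : PrimeSpectrum (M ⊗[K] maxUnramified K)} :
    g ∈ geomStabilizer K M G z ↔ geomActSpec K M g z = z := by
  have h := isArtinianRing_tensorProduct_right (K := K) (U := maxUnramified K) (M := M)
  change geomActSpec K M g '' connectedComponent z = connectedComponent z ↔ _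
  have hz : connectedComponent z = {z} :=
    @connectedComponent_primeSpectrum_eq_singleton (M ⊗[K] maxUnramified K) _ h z
  rw [hz, Set.image_singleton, Set.singleton_eq_singleton_iff]

/-- The stabilizer of a geometric component in terms of conjugacy over `K^ur`. -/
theorem mem_geomStabilizer_iff_exists_algEquiv {g : G}
    {z : PrimeSpectrum (M ⊗[K] maxUnramified K)} {χ : M →ₐ[K] SeparableClosure K}
    (hχ : ∀ t, t ∈ z.asIdeal ↔ geomPoint (maxUnramified K) χ t = 0) :
    g ∈ geomStabilizer K M G z ↔
      ∃ τ : SeparableClosure K ≃ₐ[maxUnramified K] SeparableClosure K,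
        ∀ m, τ (χ m) = χ (op g • m) := by
  set χg : M →ₐ[K] SeparableClosure K := χ.comp (MulSemiringAction.toAlgHom K M (op g)) with hχg
  have h1 : ∀ t, geomPoint (maxUnramified K) χ (geomAct K M g t) =
      geomPoint (maxUnramified K) χg t := fun t => by
    induction t with
    | zero => simp
    | add x y hx hy => rw [map_add, map_add, hx, hy, map_add]
    | tmul a b => simp [geomPoint, geomAct, χg]
  have h2 : ∀ t, t ∈ (geomActSpec K M g z).asIdeal ↔
      geomPoint (maxUnramified K) χg t = 0 := fun t => by
    rw [← h1, ← hχ]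
    rfl
  rw [mem_geomStabilizer_iff_eq, PrimeSpectrum.ext_iff, SetLike.ext_iff]
  simp only [h2, hχ]
  exact forall_geomPoint_eq_zero_iff χ χg

end GeomStabilizer

/-! ### Roots of unity and automorphisms of residue fields. -/

theorem exists_pow_eq_one_of_isIntegral_of_finite {k κ : Type*} [Field k] [Finite k] [Field κ]
    [Algebra k κ] {x : κ} (hx : IsIntegral k x) (hx0 : x ≠ 0) :
    ∃ N : ℕ, N ≠ 0 ∧ (N : κ) ≠ 0 ∧ x ^ N = 1 := by
  let E := IntermediateField.adjoin k {x}
  have : FiniteDimensional k E := IntermediateField.adjoin.finiteDimensional hx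
  have : Finite E := Module.finite_of_finite k
  cases nonempty_fintype E
  have hc : Fintype.card E = Fintype.card E - 1 + 1 := by
    have := Fintype.one_lt_card (α := E)
    omega
  refine ⟨Fintype.card E - 1, ?_, fun h => ?_, ?_⟩
  · have := Fintype.one_lt_card (α := E)
    omega
  -- The exponent is `#E - 1`, which is `-1` in characteristic `p`, hence nonzero.
  · have h1 : ((Fintype.card E : ℕ) : κ) = 0 := by
      have := congrArg (algebraMap E κ) (FiniteField.cast_card_eq_zero E)
      rwa [map_natCast, map_zero] at this
    rw [hc, Nat.cast_add, h, Nat.cast_one, zero_add] at h1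
    exact one_ne_zero h1
  · have h1 := FiniteField.pow_card_sub_one_eq_one
      (⟨x, IntermediateField.mem_adjoin_simple_self _ _⟩ : E)
      (fun h => hx0 (congrArg Subtype.val h))
    exact congrArg Subtype.val h1

/-- A generalized form of the existence of Teichmüller representatives: modulo a prime of the ring
of integers every element is zero or a root of unity of order prime to the residue characteristic. -/
theorem exists_pow_eq_one_sub_mem {R Ω : Type*} [CommRing R] [IsLocalRing R]
    [Finite (IsLocalRing.ResidueField R)] [Field Ω] [IsSepClosed Ω] [Algebra R Ω]
    (𝔫 : Ideal (integralClosure R Ω)) [𝔫.IsPrime]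
    (h𝔫 : ∀ a ∈ IsLocalRing.maximalIdeal R, algebraMap R (integralClosure R Ω) a ∈ 𝔫)
    (x : integralClosure R Ω) :
    x ∈ 𝔫 ∨ ∃ (y : integralClosure R Ω) (N : ℕ),
      IsUnit (N : R) ∧ N ≠ 0 ∧ (y : Ω) ^ N = 1 ∧ x - y ∈ 𝔫 := by
  have hcomap : 𝔫.comap (algebraMap R _) = IsLocalRing.maximalIdeal R :=
    (IsLocalRing.maximalIdeal.isMaximal R).eq_of_le
      (Ideal.IsPrime.ne_top (Ideal.comap_isPrime _ _)) h𝔫 |>.symm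
  have hmax : 𝔫.IsMaximal := Ideal.isMaximal_of_isIntegral_of_isMaximal_comap (R := R) 𝔫
    (hcomap ▸ IsLocalRing.maximalIdeal.isMaximal R)
  let := Ideal.Quotient.field 𝔫
  let i : IsLocalRing.ResidueField R →+* integralClosure R Ω ⧸ 𝔫 :=
    Ideal.Quotient.lift _ ((Ideal.Quotient.mk 𝔫).comp (algebraMap R _)) fun a ha =>
      Ideal.Quotient.eq_zero_iff_mem.mpr (h𝔫 a ha)
  let := i.toAlgebra
  have : IsScalarTower R (IsLocalRing.ResidueField R) (integralClosure R Ω ⧸ 𝔫) :=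
    IsScalarTower.of_algebraMap_eq fun a => rfl
  set xb := Ideal.Quotient.mk 𝔫 x with hxb
  have hint : IsIntegral (IsLocalRing.ResidueField R) xb := by
    have h1 : IsIntegral R xb :=
      (Algebra.IsIntegral.isIntegral (R := R) x).map (Ideal.Quotient.mkₐ R 𝔫)
    exact h1.tower_top
  by_cases hx0 : xb = 0
  · exact Or.inl (Ideal.Quotient.eq_zero_iff_mem.mp hx0)
  right
  obtain ⟨N, hN0, hNκ, hxN⟩ := exists_pow_eq_one_of_isIntegral_of_finite hint hx0
  have hNu : IsUnit (N : R) := by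
    by_contra hu
    have := Ideal.Quotient.eq_zero_iff_mem.mpr (h𝔫 N hu)
    exact hNκ (by simpa using this)
  have hNΩ : (N : Ω) ≠ 0 := by
    have := (hNu.map (algebraMap R Ω)).ne_zero
    simpa using this
  have hmonic : (Polynomial.X ^ N - 1 : Polynomial Ω).Monic := Polynomial.monic_X_pow_sub_C _ hN0
  have hsplit : (Polynomial.X ^ N - 1 : Polynomial Ω).Splits :=
    IsSepClosed.splits_of_separable _ (Polynomial.separable_X_pow_sub_C _ hNΩ one_ne_zero)
  have hroot : ∀ ζ ∈ (Polynomial.X ^ N - 1 : Polynomial Ω).roots, ζ ^ N = 1 := fun ζ hζ => by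
    have := Polynomial.isRoot_of_mem_roots hζ
    simpa [Polynomial.IsRoot, sub_eq_zero] using this
  have heval := hsplit.eval_eq_prod_roots_of_monic hmonic (x : Ω)
  generalize (Polynomial.X ^ N - 1 : Polynomial Ω).roots = s at heval hroot
  lift s to Multiset (integralClosure R Ω) using
    fun ζ hζ => IsIntegral.of_pow (Nat.pos_of_ne_zero hN0) ((hroot ζ hζ) ▸ isIntegral_one)
  -- The product of the `x - ζ` over all `N`-th roots of unity is `x ^ N - 1`, which lies in the
  -- prime `𝔫`; so one factor does.
  have hprod : (s.map fun ζ => x - ζ).prod ∈ 𝔫 := by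
    have h1 : (s.map fun ζ => x - ζ).prod = x ^ N - 1 := by
      apply Subtype.ext
      simp only [Polynomial.eval_sub, Polynomial.eval_pow, Polynomial.eval_X,
        Polynomial.eval_one] at heval
      rw [AddSubgroupClass.coe_sub, SubmonoidClass.coe_pow, OneMemClass.coe_one, heval,
        ← Subalgebra.coe_val, map_multiset_prod, Multiset.map_map, Multiset.map_map]
      rfl
    rw [h1, ← Ideal.Quotient.eq_zero_iff_mem, map_sub, map_pow, ← hxb, hxN, map_one, sub_self]
  rw [‹𝔫.IsPrime›.multiset_prod_mem_iff_exists_mem] at hprod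
  obtain ⟨_, hmem, hy⟩ := hprod
  obtain ⟨ζ, hζ, rfl⟩ := Multiset.mem_map.mp hmem
  exact ⟨ζ, N, hNu, hN0, hroot ζ (Multiset.mem_map_of_mem _ hζ), hy⟩

section Residue

open scoped Pointwise in
/-- Automorphisms of the residue field at a prime `𝔫` of the ring of integers of a Galois extension
lift to Galois automorphisms. -/
theorem exists_galois_sub_mem {R L Ω : Type*} [CommRing R] [Field L] [Field Ω] [Algebra L Ω]
    [IsGalois L Ω] [Algebra R Ω] [SMulCommClass (Ω ≃ₐ[L] Ω) R Ω]
    (𝔫 : Ideal (integralClosure R Ω)) [𝔫.IsPrime]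
    (σ : integralClosure R Ω ≃+* integralClosure R Ω) (hσ𝔫 : 𝔫 = 𝔫.map (σ : _ →+* _))
    (hσ : ∀ b : integralClosure R Ω, (b : Ω) ∈ (algebraMap L Ω).range → σ b - b ∈ 𝔫) :
    ∃ τ : Ω ≃ₐ[L] Ω, ∀ b : integralClosure R Ω, τ • b - σ b ∈ 𝔫 := by
  let B := integralClosure R Ω
  let A := FixedPoints.subalgebra R B (Ω ≃ₐ[L] Ω)
  -- Stabilizers of integral elements are open, so the profinite Galois group acts continuously on
  -- the discrete ring `B`, and its decomposition group surjects onto the automorphisms of the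
  -- residue extension.
  let : TopologicalSpace B := ⊥
  have : DiscreteTopology B := ⟨rfl⟩
  have : ContinuousSMul (Ω ≃ₐ[L] Ω) B := by
    rw [continuousSMul_iff_stabilizer_isOpen]
    intro x
    have hx : IsIntegral L (x : Ω) := Algebra.IsIntegral.isIntegral _
    have : FiniteDimensional L (IntermediateField.adjoin L {(x : Ω)}) :=
      IntermediateField.adjoin.finiteDimensional hx
    refine Subgroup.isOpen_mono (H₁ := (IntermediateField.adjoin L {(x : Ω)}).fixingSubgroup) ?_
      (IntermediateField.fixingSubgroup_isOpen _)
    intro τ hτ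
    exact Subtype.ext (hτ ⟨x, IntermediateField.mem_adjoin_simple_self L _⟩)
  have : Algebra.IsInvariant A B (Ω ≃ₐ[L] Ω) := ⟨fun b hb => ⟨⟨b, hb⟩, rfl⟩⟩
  have hA : ∀ a : A, ((a : B) : Ω) ∈ (algebraMap L Ω).range := fun a =>
    (InfiniteGalois.mem_range_algebraMap_iff_fixed _).mpr fun τ => congrArg Subtype.val (a.2 τ)
  let f : (B ⧸ 𝔫) ≃ₐ[A ⧸ 𝔫.under A] (B ⧸ 𝔫) :=
    AlgEquiv.ofRingEquiv (f := Ideal.quotientEquiv 𝔫 𝔫 σ hσ𝔫) <| by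
      intro a
      obtain ⟨a, rfl⟩ := Ideal.Quotient.mk_surjective a
      exact (Ideal.Quotient.mk_eq_mk_iff_sub_mem _ _).mpr (hσ a (hA a))
  obtain ⟨τ, hτ⟩ := Ideal.Quotient.stabilizerHom_surjective_of_profinite (G := Ω ≃ₐ[L] Ω)
    (𝔫.under A) 𝔫 f
  refine ⟨τ, fun b => ?_⟩
  exact (Ideal.Quotient.mk_eq_mk_iff_sub_mem _ _).mp
    (DFunLike.congr_fun hτ (Ideal.Quotient.mk 𝔫 b))

variable {K : Type*} [Field K] [ValuativeRel K] [TopologicalSpace K]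
  [IsNonarchimedeanLocalField K]

/-- A Galois automorphism acting trivially on a residue field of `K^sep` is trivial on `K^ur`. -/
theorem algEquiv_apply_eq_of_mem_maxUnramified
    (𝔫 : Ideal (integralClosure 𝒪[K] (SeparableClosure K))) (h𝔫 : 𝔫 ≠ ⊤)
    (τ : SeparableClosure K ≃ₐ[K] SeparableClosure K)
    (hτ : ∀ x y : integralClosure 𝒪[K] (SeparableClosure K), (y : SeparableClosure K) = τ x →
      y - x ∈ 𝔫) {a : SeparableClosure K} (ha : a ∈ maxUnramified K) : τ a = a := by
  have hle : maxUnramified K ≤ IntermediateField.fixedField (Subgroup.zpowers τ) := by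
    refine sSup_le ?_
    rintro F ⟨hF, hFu⟩
    have : Module.Finite 𝒪[K] (integralClosure 𝒪[K] F) :=
      IsIntegralClosure.finite 𝒪[K] K F (integralClosure 𝒪[K] F)
    let f₁ : F →ₐ[K] SeparableClosure K := F.val
    let f₂ : F →ₐ[K] SeparableClosure K := (τ : _ →ₐ[K] _).comp F.val
    -- On an unramified ring of integers the inclusion and its composite with `τ` agree modulo `𝔫`,
    -- hence are equal; clearing denominators extends this to `F`.
    have heq : (f₁.restrictScalars 𝒪[K]).mapIntegralClosure =
        (f₂.restrictScalars 𝒪[K]).mapIntegralClosure :=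
      Algebra.FormallyUnramified.algHom_eq_of_forall_sub_mem 𝔫 h𝔫 _ _ fun s => hτ _ _ rfl
    rw [IntermediateField.le_iff_le, Subgroup.zpowers_le]
    intro x
    obtain ⟨r, hr0, hr⟩ := ((IsFractionRing.isAlgebraic_iff 𝒪[K] K F).mpr
      (Algebra.IsAlgebraic.isAlgebraic x)).exists_integral_multiple
    have h1 : ((r • x : F) : SeparableClosure K) = τ ((r • x : F) : SeparableClosure K) :=
      congrArg Subtype.val (DFunLike.congr_fun heq ⟨r • x, hr⟩)
    have h2 : ((r • x : F) : SeparableClosure K) = algebraMap K _ r * x := by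
      rw [Algebra.smul_def]
      rfl
    rw [h2, map_mul, AlgEquiv.commutes] at h1
    have h3 : algebraMap K (SeparableClosure K) r ≠ 0 := by simpa using hr0
    exact (mul_left_cancel₀ h3 h1).symm
  exact (IntermediateField.mem_fixedField_iff _ _).mp (hle ha) τ (Subgroup.mem_zpowers τ)

end Residue

/-! ### The stabilizer of a geometric component as an inertia group. -/

section Inertia

/-- A point of a reduced artinian ring is cut out by an idempotent. -/
theorem exists_isIdempotentElem_forall_mul_eq_zero {M Ω : Type*} [CommRing M] [IsArtinianRing M]
    [IsReduced M] [Field Ω] (χ : M →+* Ω) :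
    ∃ e : M, IsIdempotentElem e ∧ χ e = 1 ∧ ∀ m, χ m = 0 → e * m = 0 := by
  have := RingHom.ker_isPrime χ
  obtain ⟨e, hep, he, heq⟩ := IsArtinianRing.exists_not_mem_forall_mem_of_ne (RingHom.ker χ)
  refine ⟨e, he, (IsIdempotentElem.iff_eq_zero_or_one.mp (he.map χ)).resolve_left hep,
    fun m hm => ?_⟩
  have h : e * m ∈ nilradical M := by
    rw [nilradical_eq_sInf, Ideal.mem_sInf]
    intro q hq
    by_cases hqp : q = RingHom.ker χ
    · subst hqp
      exact Ideal.mul_mem_left _ _ hm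
    · exact Ideal.mul_mem_right _ _ (heq q hq hqp)
  rwa [nilradical_eq_zero] at h

theorem IsIdempotentElem.isIntegral {R M : Type*} [CommRing R] [CommRing M] [Algebra R M] {e : M}
    (he : IsIdempotentElem e) : IsIntegral R e := by
  refine ⟨Polynomial.X ^ 2 - Polynomial.X, Polynomial.monic_X_pow_sub
    (Polynomial.degree_X_le.trans_lt (by norm_num)), ?_⟩
  simp [sq, he.eq]

/-- Cutting down by the idempotent of a point preserves integrality of the value there. -/
theorem isIntegral_idempotent_mul {R M Ω : Type*} [CommRing R] [CommRing M] [Algebra R M] [Field Ω]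
    [Algebra R Ω] (χ : M →ₐ[R] Ω) {e : M} (he : IsIdempotentElem e)
    (h0 : ∀ m, χ m = 0 → e * m = 0) {m : M} (hm : IsIntegral R (χ m)) : IsIntegral R (e * m) := by
  obtain ⟨f, hf, hfm⟩ := hm
  refine ⟨Polynomial.X * f, Polynomial.monic_X.mul hf, ?_⟩
  have h1 : e * Polynomial.aeval m f = 0 := h0 _ <| by
    rw [← Polynomial.aeval_algHom_apply]
    exact hfm
  obtain ⟨c, hc⟩ := Polynomial.sub_dvd_eval_sub (e * m) m (f.map (algebraMap R M))
  rw [Polynomial.eval_map_algebraMap, Polynomial.eval_map_algebraMap] at hc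
  rw [Polynomial.eval₂_mul, Polynomial.eval₂_X, ← Polynomial.aeval_def]
  have h2 := he.eq
  linear_combination (e * m) * hc + m * h1 + c * m * m * h2

variable {K M : Type u} {G : Type*} [Field K] [ValuativeRel K] [Group G] [CommRing M] [Algebra K M]
  [MulSemiringAction Gᵐᵒᵖ M] [SMulCommClass Gᵐᵒᵖ K M]

instance : SMulCommClass Gᵐᵒᵖ 𝒪[K] M := ⟨fun g a m => smul_comm g (a : K) m⟩

variable [TopologicalSpace K] [IsNonarchimedeanLocalField K] [IsGEtale K G M]

/-- The stabilizer of a geometric component is an inertia group. -/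
theorem mem_geomStabilizer_iff_forall_op_smul_sub_mem
    {z : PrimeSpectrum (M ⊗[K] maxUnramified K)} {χ : M →ₐ[K] SeparableClosure K}
    (hχ : ∀ t, t ∈ z.asIdeal ↔ geomPoint (maxUnramified K) χ t = 0)
    (𝔫 : Ideal (integralClosure 𝒪[K] (SeparableClosure K))) [𝔫.IsPrime]
    (hinv : ∀ (τ : SeparableClosure K ≃ₐ[K] SeparableClosure K)
      (x y : integralClosure 𝒪[K] (SeparableClosure K)), (y : SeparableClosure K) = τ x →
        x ∈ 𝔫 → y ∈ 𝔫)
    (h𝔫 : ∀ a ∈ 𝓂[K], algebraMap 𝒪[K] (integralClosure 𝒪[K] (SeparableClosure K)) a ∈ 𝔫) (g : G) :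
    g ∈ geomStabilizer K M G z ↔ ∀ a : integralClosure 𝒪[K] M,
      (χ.restrictScalars 𝒪[K]).mapIntegralClosure (op g • a) -
        (χ.restrictScalars 𝒪[K]).mapIntegralClosure a ∈ 𝔫 := by
  have : Algebra.Etale K M := IsGEtale.etale G
  have : Module.Finite K M := IsGEtale.finite G
  have : IsArtinianRing M := isArtinian_of_tower K inferInstance
  have : IsReduced M := Algebra.FormallyUnramified.isReduced_of_field K M
  rw [mem_geomStabilizer_iff_exists_algEquiv hχ]
  constructor
  · rintro ⟨τ, hτ⟩ a
    set b := (χ.restrictScalars 𝒪[K]).mapIntegralClosure a with hb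
    set b' := (χ.restrictScalars 𝒪[K]).mapIntegralClosure (op g • a) with hb'
    have hbb' : (b' : SeparableClosure K) = τ.restrictScalars K b := (hτ a).symm
    -- Modulo `𝔫`, `b` is zero or a root of unity of invertible order. The latter lies in `K^ur`, so
    -- `τ` fixes it and `τ b` is congruent to `b` either way.
    rcases exists_pow_eq_one_sub_mem 𝔫 h𝔫 b with h | ⟨y, N, hN, hN0, hyN, hy⟩
    · exact 𝔫.sub_mem (hinv _ b b' hbb' h) h
    · have hyu := mem_maxUnramified_of_pow_eq_one K hN hN0 y hyN
      have h1 : b' - y ∈ 𝔫 := hinv (τ.restrictScalars K) (b - y) _ (by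
        have h2 : τ (y : SeparableClosure K) = y := τ.commutes ⟨y, hyu⟩
        have h3 : (b' : SeparableClosure K) = τ b := hbb'
        simp [h2, h3]) hy
      have := 𝔫.sub_mem h1 hy
      rwa [sub_sub_sub_cancel_right] at this
  · intro H
    obtain ⟨e, he, he1, he0⟩ := exists_isIdempotentElem_forall_mul_eq_zero (χ : M →+* SeparableClosure K)
    simp only [RingHom.coe_coe] at he1 he0
    -- The value is `0` or `1` and is congruent to `χ e = 1` modulo `𝔫`. Thus `g` preserves the
    -- point of `Spec M` under `χ`, and acts there through some Galois element `σ`.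
    have hge : χ (op g • e) = 1 := by
      have h1 : IsIdempotentElem (χ (op g • e)) :=
        (he.map (MulSemiringAction.toRingHom Gᵐᵒᵖ M (op g))).map χ
      refine (IsIdempotentElem.iff_eq_zero_or_one.mp h1).resolve_left fun h0 => ?_
      have h2 := H ⟨e, he.isIntegral⟩
      refine ‹𝔫.IsPrime›.ne_top ((Ideal.eq_top_iff_one _).mpr ?_)
      convert 𝔫.neg_mem h2
      apply Subtype.ext
      change (1 : SeparableClosure K) = -(χ (op g • e) - χ e)
      rw [h0, he1]
      ring
    have hker : RingHom.ker χ = RingHom.ker (χ.comp (MulSemiringAction.toAlgHom K M (op g))) := by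
      have := RingHom.ker_isPrime χ
      have := IsArtinianRing.isMaximal_of_isPrime (RingHom.ker χ)
      refine this.eq_of_le (RingHom.ker_ne_top _) fun m hm => ?_
      have h1 := congrArg (fun x => χ (op g • x)) (he0 m hm)
      simpa [hge] using h1
    obtain ⟨σ, hσ⟩ := exists_algEquiv_of_ker_eq _ _ hker
    let L : IntermediateField K (SeparableClosure K) :=
      χ.range.toIntermediateField fun x hx =>
        χ.range.inv_mem_of_algebraic (x := ⟨x, hx⟩) (Algebra.IsAlgebraic.isAlgebraic x)
    let σ' := ((σ.restrictScalars 𝒪[K]).mapIntegralClosure).toRingEquiv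
    have hσ' : ∀ b, ((σ' b : integralClosure 𝒪[K] (SeparableClosure K)) : SeparableClosure K) =
      σ b := fun b => rfl
    have : SMulCommClass (SeparableClosure K ≃ₐ[L] SeparableClosure K) 𝒪[K] (SeparableClosure K) :=
      ⟨fun τ r x => map_smul (τ.restrictScalars K) (r : K) x⟩
    have hmem : ∀ x, σ' x ∈ 𝔫 ↔ x ∈ 𝔫 := fun x =>
      ⟨hinv σ.symm (σ' x) x (by simp [hσ']), hinv σ x (σ' x) rfl⟩
    -- `σ` is trivial modulo `𝔫` on the integers of `L`, the image of `χ`: such an integer is the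
    -- value at `χ` of an integral `e * m`. So some `τ` over `L` has the same residue action as `σ`.
    -- Then `σ τ⁻¹` is trivial on the residue field, hence fixes `K^ur`, and it still agrees with
    -- `σ` on `L`.
    obtain ⟨τ, hτ⟩ := exists_galois_sub_mem (L := L) 𝔫 σ' (by
        ext x
        obtain ⟨x, rfl⟩ := σ'.surjective x
        rw [hmem]
        exact (Ideal.mem_map_of_equiv σ' _).trans ⟨fun ⟨y, hy, h⟩ => σ'.injective h ▸ hy,
          fun h => ⟨x, h, rfl⟩⟩ |>.symm) (by
        rintro b ⟨⟨_, m, rfl⟩, hb⟩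
        replace hb : χ m = b := hb
        have hint : IsIntegral 𝒪[K] (e * m) :=
          isIntegral_idempotent_mul (χ.restrictScalars 𝒪[K]) he he0 (hb ▸ b.2)
        convert H ⟨e * m, hint⟩
        · apply Subtype.ext
          rw [hσ', ← hb, hσ]
          change _ = χ (op g • (e * m))
          simp [hge]
        · apply Subtype.ext
          change _ = χ (e * m)
          rw [map_mul, he1, one_mul, hb])
    let τ₁ : SeparableClosure K ≃ₐ[K] SeparableClosure K := (τ.restrictScalars K).symm.trans σ
    have hτ₁ : ∀ x y : integralClosure 𝒪[K] (SeparableClosure K), (y : SeparableClosure K) = τ₁ x →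
        y - x ∈ 𝔫 := fun x y hxy => by
      have h1 := 𝔫.neg_mem (hτ (τ⁻¹ • x))
      rw [smul_inv_smul, neg_sub] at h1
      convert h1
      exact Subtype.ext hxy
    refine ⟨AlgEquiv.ofRingEquiv (f := τ₁.toRingEquiv) fun a =>
      algEquiv_apply_eq_of_mem_maxUnramified 𝔫 ‹𝔫.IsPrime›.ne_top τ₁ hτ₁ a.2, fun m => ?_⟩
    change σ (τ.symm (χ m)) = _
    have h1 : τ.symm (χ m) = χ m := τ.symm.commutes ⟨χ m, m, rfl⟩
    rw [h1, hσ]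
    rfl

end Inertia

/-! ### Freeness of the tuning module. -/

section Points

/-- An element of a `G`-étale algebra vanishing at all conjugates of a point vanishes. -/
theorem eq_zero_of_forall_op_smul {K G M Ω : Type*} [Field K] [Group G] [Finite G]
    [CommRing M] [Algebra K M] [MulSemiringAction Gᵐᵒᵖ M] [SMulCommClass Gᵐᵒᵖ K M]
    [IsGEtale K G M] [Field Ω] [Algebra K Ω] (χ : M →ₐ[K] Ω) {m : M}
    (hm : ∀ g : G, χ (op g • m) = 0) : m = 0 := by
  have : Algebra.Etale K M := IsGEtale.etale G
  have : Module.Finite K M := IsGEtale.finite G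
  have : IsArtinianRing M := isArtinian_of_tower K inferInstance
  have : IsReduced M := Algebra.FormallyUnramified.isReduced_of_field K M
  have : Finite Gᵐᵒᵖ := Finite.of_equiv G MulOpposite.opEquiv
  cases nonempty_fintype Gᵐᵒᵖ
  obtain ⟨e, he, he1, he0⟩ := exists_isIdempotentElem_forall_mul_eq_zero (χ : M →+* Ω)
  simp only [RingHom.coe_coe] at he1 he0
  have hem : ∀ γ : Gᵐᵒᵖ, (γ • e) * m = 0 := fun γ => by
    have h1 : e * γ⁻¹ • m = 0 := he0 _ (hm (unop γ⁻¹))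
    have h2 := congrArg (γ • ·) h1
    simpa only [smul_mul', smul_inv_smul, smul_zero] using h2
  -- The invariant product `∏ (1 - γ • e)` lies in `K` and is killed by `χ`, so it is zero; yet it
  -- acts on `m` as the identity, since each `γ • e` kills `m`.
  obtain ⟨k, hk⟩ := (IsGEtale.invariant_iff (K := K) (G := G) (∏ γ : Gᵐᵒᵖ, (1 - γ • e))).mp
    fun g => by
      rw [Finset.smul_prod']
      exact Fintype.prod_equiv (Equiv.mulLeft (op g)) _ _ fun γ => by
        simp [smul_sub, mul_smul]
  have hk0 : k = 0 := by
    have h1 := congrArg χ hk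
    rw [AlgHom.commutes, map_prod, Finset.prod_eq_zero (Finset.mem_univ (1 : Gᵐᵒᵖ)) (by simp [he1])]
      at h1
    simpa using h1
  have h2 : ∀ s : Finset Gᵐᵒᵖ, (∏ γ ∈ s, (1 - γ • e)) * m = m := fun s => by
    classical
    induction s using Finset.induction_on with
    | empty => simp
    | insert γ s hγ ih => rw [Finset.prod_insert hγ, mul_assoc, ih, sub_mul, hem, one_mul, sub_zero]
  rw [← h2 Finset.univ, ← hk, hk0, map_zero, zero_mul]

/-- After clearing denominators, agreement on integral elements would be agreement on `M`,
contradicting freeness of the action on points. This is the separation hypothesis for the trivial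
subgroup. -/
theorem exists_op_smul_ne {K M Ω : Type u} {G : Type*} [Field K] [Infinite K]
    [Group G] [Finite G] [CommRing M] [Algebra K M] [MulSemiringAction Gᵐᵒᵖ M]
    [SMulCommClass Gᵐᵒᵖ K M] [IsGEtale K G M] [Field Ω] [Algebra K Ω] [IsSepClosed Ω]
    (χ : M →ₐ[K] Ω) (R : Type*) [CommRing R] [IsDomain R] [Algebra R K] [IsFractionRing R K]
    [Algebra R M] [IsScalarTower R K M] {g : G} (hg : g ≠ 1) :
    ∃ m, IsIntegral R m ∧ χ (op g • m) ≠ χ m := by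
  have : Module.Finite K M := IsGEtale.finite G
  by_contra! H
  refine hg (op_smul_injective_of_isSepClosed χ g 1 fun x => ?_)
  obtain ⟨r, hr0, hr⟩ := ((IsFractionRing.isAlgebraic_iff R K M).mpr
      (Algebra.IsAlgebraic.isAlgebraic x)).exists_integral_multiple
  have h1 := H _ hr
  rw [← algebraMap_smul K r x, smul_comm (op g) (algebraMap R K r) x, Algebra.smul_def, Algebra.smul_def,
    map_mul, map_mul, AlgHom.commutes] at h1
  rw [op_one, one_smul]
  exact mul_left_cancel₀ (by simpa using hr0) h1

end Points

section Tuning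

variable {K M : Type*} {G : Type*} [Field K] [ValuativeRel K] [Group G] [CommRing M] [Algebra K M]
  [MulSemiringAction Gᵐᵒᵖ M] [SMulCommClass Gᵐᵒᵖ K M] {n : ℕ} (ρ : G →* GL (Fin n) 𝒪[K])

instance : SMulCommClass Gᵐᵒᵖ 𝒪[K] (integralClosure 𝒪[K] M) :=
  ⟨fun g a m => Subtype.ext (smul_comm g (a : K) (m : M))⟩

theorem mem_tuningModule_iff (φ : (Fin n → 𝒪[K]) →ₗ[𝒪[K]] integralClosure 𝒪[K] M) :
    φ ∈ tuningModule ρ M ↔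
      (fun i => φ (Pi.single i 1)) ∈ equivariantVectors (integralClosure 𝒪[K] M) ρ := by
  have key : ∀ (g : G) (i : Fin n), Matrix.mulVec
      ((ρ g).1.map (algebraMap 𝒪[K] (integralClosure 𝒪[K] M))) (fun i => φ (Pi.single i 1)) i =
        φ (Matrix.vecMul (Pi.single i 1) (ρ g).1) := fun g i => by
    have h1 : ∀ j : Fin n, (fun l => if j = l then (1 : 𝒪[K]) else 0) = Pi.single j 1 := fun j => by
      funext l
      simp [Pi.single_apply, eq_comm]
    rw [Matrix.single_one_vecMul, LinearMap.pi_apply_eq_sum_univ φ]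
    simp only [h1, Matrix.mulVec, dotProduct, Algebra.smul_def, Matrix.map_apply, Matrix.row_apply]
  rw [mem_equivariantVectors]
  constructor
  · intro h g
    funext i
    rw [key]
    exact Subtype.ext (h g _)
  · intro h g c
    let ψ : (Fin n → 𝒪[K]) →ₗ[𝒪[K]] integralClosure 𝒪[K] M :=
      φ ∘ₗ Matrix.vecMulLinear (ρ g).1
    let ψ' : (Fin n → 𝒪[K]) →ₗ[𝒪[K]] integralClosure 𝒪[K] M :=
      DistribSMul.toLinearMap 𝒪[K] _ (op g) ∘ₗ φ
    have : ψ = ψ' := by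
      refine LinearMap.pi_ext' fun i => LinearMap.ext_ring ?_
      have := congrFun (h g) i
      rw [key] at this
      exact this
    exact congrArg Subtype.val (DFunLike.congr_fun this c)

variable (M) in
/-- The tuning module as the module of equivariant vectors `(φ (xᵢ))ᵢ`. -/
def tuningModuleEquiv :
    tuningModule ρ M ≃ₗ[𝒪[K]] equivariantVectors (integralClosure 𝒪[K] M) ρ :=
  LinearEquiv.ofSubmodules ((Pi.basisFun 𝒪[K] (Fin n)).constr 𝒪[K]).symm _ _ <| by
    ext v
    rw [Submodule.mem_map_equiv, mem_tuningModule_iff, LinearEquiv.symm_symm]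
    have h1 : (fun i => (Pi.basisFun 𝒪[K] (Fin n)).constr 𝒪[K] v (Pi.single i 1)) = v := by
      funext i
      rw [← Pi.basisFun_apply, Module.Basis.constr_basis]
    rw [h1]

theorem tuningModuleEquiv_apply (φ : tuningModule ρ M) (i : Fin n) :
    (tuningModuleEquiv M ρ φ : Fin n → integralClosure 𝒪[K] M) i = φ.1 (Pi.single i 1) := by
  rw [← Pi.basisFun_apply]
  rfl

end Tuning

section Freeness

variable {K M : Type u} {G : Type*} [Field K] [ValuativeRel K] [TopologicalSpace K]
  [IsNonarchimedeanLocalField K] [Group G] [Finite G] [CommRing M] [Algebra K M]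
  [MulSemiringAction Gᵐᵒᵖ M] [SMulCommClass Gᵐᵒᵖ K M] [IsGEtale K G M] {n : ℕ}

theorem infinite_of_isNonarchimedeanLocalField (K : Type*) [Field K] [ValuativeRel K]
    [TopologicalSpace K] [IsNonarchimedeanLocalField K] : Infinite K := by
  by_contra h
  rw [not_infinite_iff_finite] at h
  exact IsDiscreteValuationRing.not_isField 𝒪[K] (Finite.isField_of_domain 𝒪[K])

instance : Algebra.IsInvariant 𝒪[K] (integralClosure 𝒪[K] M) Gᵐᵒᵖ where
  isInvariant b hb := by
    obtain ⟨k, hk⟩ := (IsGEtale.invariant_iff (K := K) (G := G) (b : M)).mp fun g =>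
      congrArg Subtype.val (hb (op g))
    have : Nontrivial M := by
      have : Module.Finite K M := IsGEtale.finite G
      refine Module.nontrivial_of_finrank_pos (R := K) ?_
      rw [IsGEtale.finrank_eq (G := G)]
      exact Nat.card_pos
    have h1 : IsIntegral 𝒪[K] k := by
      have h2 : IsIntegral 𝒪[K] (algebraMap K M k) := hk ▸ b.2
      exact (isIntegral_algHom_iff (IsScalarTower.toAlgHom 𝒪[K] K M)
        (algebraMap K M).injective).mp h2
    obtain ⟨a, rfl⟩ := IsIntegrallyClosed.isIntegral_iff.mp h1
    exact ⟨a, Subtype.ext hk⟩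

theorem nonempty_basis_tuningModule (ρ : G →* GL (Fin n) 𝒪[K]) (χ : M →ₐ[K] SeparableClosure K) :
    Nonempty (Module.Basis (Fin n) 𝒪[K] (tuningModule ρ M)) := by
  have := infinite_of_isNonarchimedeanLocalField K
  let A := integralClosure 𝒪[K] M
  let θ : A →+* SeparableClosure K := (χ : M →+* SeparableClosure K).comp (algebraMap A M)
  have hspan : Submodule.span (SeparableClosure K)
      ((θ ∘ ·) '' (equivariantVectors A ρ : Set (Fin n → A))) = ⊤ := by
    rw [eq_top_iff, ← (Pi.basisFun (SeparableClosure K) (Fin n)).span_eq, Submodule.span_le]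
    rintro _ ⟨i, rfl⟩
    -- The trivial subgroup fixes every vector, so each standard basis vector lies in the generic
    -- span.
    have h1 := comp_mem_span_equivariantVectors θ ρ ⊥ (fun g hg => by
      obtain ⟨m, hm, hne⟩ := exists_op_smul_ne χ 𝒪[K] (g := g) (by simpa using hg)
      refine ⟨⟨m, hm⟩, ?_, hne⟩
      rintro h rfl
      exact one_smul _ _) (w := Pi.single i (1 : 𝒪[K])) (by
        rintro h rfl
        simp only [map_one, Units.val_one, Matrix.one_mulVec])
    refine Set.mem_of_eq_of_mem ?_ h1
    funext j
    by_cases hij : j = i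
    · subst hij
      simp
    · simp [hij]
  obtain ⟨f, hf, -, hli⟩ := Submodule.exists_fun_fin_finrank_span_eq (SeparableClosure K)
    ((θ ∘ ·) '' (equivariantVectors A ρ : Set (Fin n → A)))
  have hrank : Module.finrank (SeparableClosure K) (Submodule.span (SeparableClosure K)
      ((θ ∘ ·) '' (equivariantVectors A ρ : Set (Fin n → A)))) = n := by
    rw [hspan, finrank_top, Module.finrank_fin_fun]
  choose w hw hwf using hf
  obtain ⟨b⟩ := free_finrank_equivariantVectors θ
    (fun x y hxy => by
      have h1 : algebraMap K (SeparableClosure K) x = algebraMap K (SeparableClosure K) y := by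
        rw [← χ.commutes, ← χ.commutes]
        exact hxy
      exact Subtype.ext ((algebraMap K (SeparableClosure K)).injective h1))
    (fun a ha => Subtype.ext (eq_zero_of_forall_op_smul χ ha)) ρ
    (fun j => w (Fin.cast hrank.symm j)) (fun j => hw _) (by
      have h1 : (fun j => θ ∘ w (Fin.cast hrank.symm j)) = f ∘ Fin.cast hrank.symm :=
        funext fun j => hwf _
      rw [h1]
      exact hli.comp (Fin.cast hrank.symm) (Fin.cast_injective _))
  exact ⟨b.map (tuningModuleEquiv M ρ).symm⟩

end Freeness

/-! ### Rank of the equivariant vectors modulo a prime. -/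

section BaseChange

open Matrix

variable {F κ : Type*} [Field F] [Field κ] {n : ℕ}

/-- Solution spaces of linear equations commute with extension of the base field. -/
theorem linZeros_image_le_span (f : F →+* κ) (S : Set (Fin n → F)) :
    linZeros ((f ∘ ·) '' S) ≤ Submodule.span κ ((f ∘ ·) '' (linZeros S : Set (Fin n → F))) := by
  classical
  intro y hy
  let := f.toAlgebra
  let β := Module.Basis.ofVectorSpace F κ
  let Y : Module.Basis.ofVectorSpaceIndex F κ → Fin n → F := fun l j => β.repr (y j) l
  have hY : ∀ l, Y l ∈ linZeros S := fun l a ha => by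
    -- Expanding the entries of `y` in an `F`-basis of `κ` splits the equations, which have
    -- coefficients in `F`, into one system for each basis element.
    have h1 : ∑ j, a j • y j = 0 := by
      simp only [Algebra.smul_def]
      exact hy _ ⟨a, ha, rfl⟩
    have h2 := DFunLike.congr_fun (congrArg β.repr h1) l
    simpa [dotProduct, Y] using h2
  have hsum : y = ∑ l ∈ Finset.univ.biUnion fun j => (β.repr (y j)).support, β l • (f ∘ Y l) := by
    funext j
    have h1 := β.linearCombination_repr (y j)
    rw [Finsupp.linearCombination_apply, Finsupp.sum_of_support_subset _
      (Finset.subset_biUnion_of_mem (fun j => (β.repr (y j)).support) (Finset.mem_univ j)) _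
      (by simp)] at h1
    conv_lhs => rw [← h1]
    rw [Finset.sum_apply]
    exact Finset.sum_congr rfl fun l _ => by
      rw [Algebra.smul_def, mul_comm]
      rfl
  rw [hsum]
  exact Submodule.sum_mem _ fun l _ => Submodule.smul_mem _ _
    (Submodule.subset_span ⟨_, hY l, rfl⟩)

/-- A matrix whose columns are a basis of `W` has a left inverse over `F`, which remains one after
applying `f`; so the columns stay independent. -/
theorem finrank_span_image_comp (f : F →+* κ) (W : Submodule F (Fin n → F)) :
    Module.finrank κ (Submodule.span κ ((f ∘ ·) '' (W : Set (Fin n → F)))) =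
      Module.finrank F W := by
  let b := Module.finBasis F W
  let B : Matrix (Fin n) (Fin (Module.finrank F W)) F := Matrix.of fun i j => (b j).1 i
  obtain ⟨q, hq⟩ := W.subtype.exists_leftInverse_of_injective W.ker_subtype
  let Q := LinearMap.toMatrix' (b.equivFun.toLinearMap ∘ₗ q)
  have hQB : Q * B = 1 := by
    have h1 : B = LinearMap.toMatrix' (W.subtype ∘ₗ b.equivFun.symm.toLinearMap) := by
      ext i j
      simp [B, LinearMap.toMatrix'_apply]
    rw [h1, ← LinearMap.toMatrix'_comp, LinearMap.comp_assoc, ← LinearMap.comp_assoc _ _ q, hq]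
    simp
  have hli : LinearIndependent κ (B.map f).col := by
    rw [← Matrix.mulVec_injective_iff]
    refine Function.LeftInverse.injective (g := (Q.map f).mulVec) fun x => ?_
    rw [Matrix.mulVec_mulVec, ← Matrix.map_mul, hQB, Matrix.map_one _ (map_zero f) (map_one f),
      Matrix.one_mulVec]
  have hspan : Submodule.span κ ((f ∘ ·) '' (W : Set (Fin n → F))) =
      Submodule.span κ (Set.range (B.map f).col) := by
    refine le_antisymm (Submodule.span_le.mpr ?_) (Submodule.span_mono ?_)
    · rintro _ ⟨w, hw, rfl⟩
      have h1 : f ∘ w = ∑ j, f (b.repr ⟨w, hw⟩ j) • (B.map f).col j := by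
        funext i
        have := congrFun (congrArg Subtype.val (b.sum_repr ⟨w, hw⟩)) i
        simp only [Submodule.coe_sum, Finset.sum_apply] at this
        simp [← this, B]
      simp only [h1]
      exact Submodule.sum_mem _ fun j _ => Submodule.smul_mem _ _
        (Submodule.subset_span ⟨j, rfl⟩)
    · rintro _ ⟨j, rfl⟩
      exact ⟨_, (b j).2, rfl⟩
  rw [hspan, finrank_span_eq_card hli, Fintype.card_fin]

end BaseChange

section Rank

open Matrix

variable {G R A F κ : Type*} [Group G] [CommRing R] [CommRing A] [Algebra R A] [Field F] [Field κ]
  {n : ℕ}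

/-- The coefficient vectors of the linear forms `xᵢ ∘ ρ h - xᵢ`, `h ∈ H`. -/
def fixedForms (ρ : G →* GL (Fin n) R) (H : Subgroup G) (r : R →+* F) : Set (Fin n → F) :=
  {a | ∃ h ∈ H, ∃ i, a = ((ρ h).1.map r - 1) i}

theorem mem_linZeros_fixedForms {ρ : G →* GL (Fin n) R} {H : Subgroup G} {r : R →+* F}
    {y : Fin n → F} :
    y ∈ linZeros (fixedForms ρ H r) ↔ ∀ h ∈ H, (ρ h).1.map r *ᵥ y = y := by
  have h1 : ∀ h, (ρ h).1.map r *ᵥ y = y ↔ ∀ i, ((ρ h).1.map r - 1) i ⬝ᵥ y = 0 := fun h => by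
    rw [← sub_eq_zero, ← Matrix.one_mulVec y, Matrix.mulVec_mulVec, mul_one, ← Matrix.sub_mulVec,
      funext_iff, Matrix.one_mulVec]
    rfl
  simp only [h1, mem_linZeros, fixedForms, Set.mem_ofPred_eq]
  constructor
  · exact fun H h hh i => H _ ⟨h, hh, i, rfl⟩
  · rintro H _ ⟨h, hh, i, rfl⟩
    exact H h hh i

theorem image_fixedForms (ρ : G →* GL (Fin n) R) (H : Subgroup G) (r : R →+* F) (f : F →+* κ) :
    (f ∘ ·) '' fixedForms ρ H r = fixedForms ρ H (f.comp r) := by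
  have h1 : ∀ h i, f ∘ ((ρ h).1.map r - 1) i = ((ρ h).1.map (f.comp r) - 1) i := fun h i => by
    funext j
    simp [Matrix.one_apply, apply_ite f]
  ext a
  constructor
  · rintro ⟨_, ⟨h, hh, i, rfl⟩, rfl⟩
    exact ⟨h, hh, i, h1 h i⟩
  · rintro ⟨h, hh, i, rfl⟩
    exact ⟨_, ⟨h, hh, i, rfl⟩, h1 h i⟩

variable [MulSemiringAction Gᵐᵒᵖ A] [SMulCommClass Gᵐᵒᵖ R A]

/-- Modulo a prime with inertia group `I`, the equivariant vectors span the vectors fixed by `I`,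
provided that fixed vectors lift. -/
theorem span_equivariantVectors_eq_linZeros [Finite G] {ρ : G →* GL (Fin n) R} {I : Subgroup G}
    {θ : A →+* κ} (hI : ∀ g, g ∈ I ↔ ∀ a, θ (op g • a) = θ a) {r : R →+* F} {f : F →+* κ}
    (hf : f.comp r = θ.comp (algebraMap R A))
    (hlift : ∀ y ∈ linZeros (fixedForms ρ I r), ∃ w, (∀ h ∈ I, (ρ h).1 *ᵥ w = w) ∧ r ∘ w = y) :
    Submodule.span κ ((θ ∘ ·) '' (equivariantVectors A ρ : Set (Fin n → A))) =
      linZeros (fixedForms ρ I (f.comp r)) := by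
  have : Finite Gᵐᵒᵖ := Finite.of_equiv G MulOpposite.opEquiv
  apply le_antisymm
  · rw [Submodule.span_le]
    rintro _ ⟨v, hv, rfl⟩
    refine mem_linZeros_fixedForms.mpr fun h hh => ?_
    funext i
    have h1 := congrArg θ (congrFun (mem_equivariantVectors.mp hv h) i)
    rw [Pi.smul_apply, (hI h).mp hh] at h1
    rw [hf]
    simpa [Matrix.mulVec, dotProduct] using h1
  · rw [← image_fixedForms]
    refine (linZeros_image_le_span f _).trans (Submodule.span_le.mpr ?_)
    rintro _ ⟨y, hy, rfl⟩
    obtain ⟨w, hw, rfl⟩ := hlift y hy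
    have h1 : f ∘ r ∘ w = θ ∘ algebraMap R A ∘ w := by
      funext i
      exact RingHom.congr_fun hf (w i)
    simp only [h1]
    refine comp_mem_span_equivariantVectors θ ρ I (fun g hg => ?_) hw
    -- The kernel of `θ` is a prime with inertia group `I`, so the characteristic polynomial
    -- argument supplies the required `I`-invariants.
    have := RingHom.ker_isPrime θ
    obtain ⟨b, hb, hgb⟩ := exists_fixed_smul_sub_notMem (RingHom.ker θ) I.op
      (fun γ => by
        rw [Subgroup.mem_op, hI]
        simp [RingHom.mem_ker, sub_eq_zero]) (g := op g) (by simpa using hg)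
    refine ⟨b, fun h hh => hb _ (by simpa using hh), ?_⟩
    simpa [RingHom.mem_ker, sub_eq_zero] using hgb

/-- The rank modulo a prime of a spanning family of equivariant vectors. -/
theorem finrank_linZeros_add_finrank_linZeros_fixedForms [Finite G] {ρ : G →* GL (Fin n) R}
    {I : Subgroup G} {θ : A →+* κ} (hI : ∀ g, g ∈ I ↔ ∀ a, θ (op g • a) = θ a) {r : R →+* F}
    {f : F →+* κ} (hf : f.comp r = θ.comp (algebraMap R A))
    (hlift : ∀ y ∈ linZeros (fixedForms ρ I r), ∃ w, (∀ h ∈ I, (ρ h).1 *ᵥ w = w) ∧ r ∘ w = y)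
    {v : Fin n → Fin n → A} (hv : Submodule.span R (Set.range v) = equivariantVectors A ρ) :
    Module.finrank κ (linZeros ((θ ∘ ·) '' Set.range fun i j => v j i)) +
      Module.finrank F (linZeros (fixedForms ρ I r)) = n := by
  -- Its kernel is the zero space on the left and its columns span the `I`-fixed vectors over `κ`;
  -- the claim is rank–nullity, with the fixed space descended from `κ` to `F`.
  let B : Matrix (Fin n) (Fin n) κ := Matrix.of fun i j => θ (v j i)
  have h1 : linZeros ((θ ∘ ·) '' Set.range fun i j => v j i) = LinearMap.ker B.mulVecLin := by
    ext y
    rw [LinearMap.mem_ker, Matrix.mulVecLin_apply, funext_iff]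
    constructor
    · exact fun h i => h _ ⟨_, ⟨i, rfl⟩, rfl⟩
    · rintro h _ ⟨_, ⟨i, rfl⟩, rfl⟩
      exact h i
  have h2 : Submodule.span κ ((θ ∘ ·) '' (equivariantVectors A ρ : Set (Fin n → A))) =
      Submodule.span κ (Set.range B.col) := by
    refine le_antisymm (Submodule.span_le.mpr ?_) (Submodule.span_mono ?_)
    · rintro _ ⟨w, hw, rfl⟩
      rw [SetLike.mem_coe, ← hv] at hw
      induction hw using Submodule.span_induction with
      | mem w hw =>
        obtain ⟨j, rfl⟩ := hw
        exact Submodule.subset_span ⟨j, rfl⟩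
      | zero =>
        have h3 : θ ∘ (0 : Fin n → A) = 0 := by
          funext i
          simp
        simp only [h3]
        exact Submodule.zero_mem _
      | add x y _ _ hx hy =>
        have h3 : θ ∘ (x + y) = θ ∘ x + θ ∘ y := by
          funext i
          simp
        simp only [h3]
        exact Submodule.add_mem _ hx hy
      | smul c x _ hx =>
        have h3 : θ ∘ (c • x) = θ (algebraMap R A c) • (θ ∘ x) := by
          funext i
          simp [Algebra.smul_def]
        simp only [h3]
        exact Submodule.smul_mem _ _ hx
    · rintro _ ⟨j, rfl⟩
      exact ⟨v j, hv ▸ Submodule.subset_span ⟨j, rfl⟩, rfl⟩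
  have h3 := B.mulVecLin.finrank_range_add_finrank_ker
  rw [← h1, ← Matrix.rank, Matrix.rank_eq_finrank_span_cols, ← h2,
    span_equivariantVectors_eq_linZeros hI hf hlift, Module.finrank_fin_fun] at h3
  rw [← finrank_span_image_comp f, add_comm]
  have h4 : Submodule.span κ ((f ∘ ·) '' (linZeros (fixedForms ρ I r) : Set (Fin n → F))) =
      linZeros (fixedForms ρ I (f.comp r)) := by
    rw [← image_fixedForms]
    refine le_antisymm (Submodule.span_le.mpr ?_) (linZeros_image_le_span f _)
    rintro _ ⟨y, hy, rfl⟩ _ ⟨a, ha, rfl⟩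
    have := congrArg f (hy a ha)
    simpa [dotProduct] using this
  rw [h4, h3]

/-- The zero space of the coordinates of equivariant vectors does not change under conjugation. -/
theorem linZeros_comp_op_smul {ρ : G →* GL (Fin n) R} (θ : A →+* κ) (g : G)
    {v : Fin n → Fin n → A} (hv : ∀ j, v j ∈ equivariantVectors A ρ) :
    linZeros (((θ.comp (MulSemiringAction.toRingHom Gᵐᵒᵖ A (op g))) ∘ ·) ''
      Set.range fun i j => v j i) = linZeros ((θ ∘ ·) '' Set.range fun i j => v j i) := by
  have key : ∀ (θ : A →+* κ) (g : G), linZeros ((θ ∘ ·) '' Set.range fun i j => v j i) ≤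
      linZeros (((θ.comp (MulSemiringAction.toRingHom Gᵐᵒᵖ A (op g))) ∘ ·) ''
        Set.range fun i j => v j i) := by
    rintro θ g y hy _ ⟨_, ⟨i, rfl⟩, rfl⟩
    have h1 : ∀ l, ∑ j, θ (v j l) * y j = 0 := fun l => hy _ ⟨_, ⟨l, rfl⟩, rfl⟩
    -- Equivariance makes each conjugated row a combination of the original rows with coefficients
    -- in `ρ g`. The other inclusion is the same statement for `g⁻¹`.
    have h2 : ∀ j, θ (op g • v j i) = ∑ l, θ (algebraMap R A ((ρ g).1 i l)) * θ (v j l) :=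
      fun j => by
        have := congrArg θ (congrFun (mem_equivariantVectors.mp (hv j) g) i)
        simpa [Matrix.mulVec, dotProduct] using this.symm
    change ∑ j, θ (op g • v j i) * y j = 0
    simp only [h2, Finset.sum_mul]
    rw [Finset.sum_comm]
    refine Finset.sum_eq_zero fun l _ => ?_
    simp only [mul_assoc, ← Finset.mul_sum, h1, mul_zero]
  refine le_antisymm ?_ (key θ g)
  have h1 := key (θ.comp (MulSemiringAction.toRingHom Gᵐᵒᵖ A (op g))) g⁻¹
  have h2 : (θ.comp (MulSemiringAction.toRingHom Gᵐᵒᵖ A (op g))).comp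
      (MulSemiringAction.toRingHom Gᵐᵒᵖ A (op g⁻¹)) = θ := by
    ext a
    simp
  rwa [h2] at h1

end Rank

/-! ### Lifting fixed vectors from the residue field, one lemma for each condition. -/

section Lifting

open Matrix

variable {G : Type*} [Group G] {R : Type*} [CommRing R] [IsLocalRing R] {n : ℕ}

/-- Average an arbitrary lift over `H`, whose order is invertible in `R`. -/
theorem exists_fixed_lift_of_not_dvd [Finite G] (ρ : G →* GL (Fin n) R)
    (hG : ¬ ringChar (IsLocalRing.ResidueField R) ∣ Nat.card G) (H : Subgroup G)
    (y : Fin n → IsLocalRing.ResidueField R)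
    (hy : ∀ h ∈ H, (ρ h).1.map (IsLocalRing.residue R) *ᵥ y = y) :
    ∃ w, (∀ h ∈ H, (ρ h).1 *ᵥ w = w) ∧ IsLocalRing.residue R ∘ w = y := by
  cases nonempty_fintype H
  obtain ⟨y', rfl⟩ : ∃ y', IsLocalRing.residue R ∘ y' = y :=
    ⟨fun i => (IsLocalRing.residue_surjective (y i)).choose,
      funext fun i => (IsLocalRing.residue_surjective (y i)).choose_spec⟩
  have hres : (Fintype.card H : IsLocalRing.ResidueField R) ≠ 0 := by
    rw [Ne, ringChar.spec, ← Nat.card_eq_fintype_card]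
    exact fun h => hG (h.trans H.card_subgroup_dvd_card)
  have hu : IsUnit (Fintype.card H : R) := by
    rw [← IsLocalRing.residue_ne_zero_iff_isUnit, map_natCast]
    exact hres
  obtain ⟨u, hu⟩ := hu
  refine ⟨(u⁻¹ : Rˣ).1 • ∑ h : H, (ρ h).1 *ᵥ y', fun s hs => ?_, ?_⟩
  · rw [Matrix.mulVec_smul, Matrix.mulVec_sum]
    congr 1
    refine Fintype.sum_equiv (Equiv.mulLeft ⟨s, hs⟩) _ _ fun h => ?_
    rw [Matrix.mulVec_mulVec, ← Units.val_mul, ← map_mul]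
    rfl
  · funext i
    have h1 : ∀ h : H, IsLocalRing.residue R (((ρ h).1 *ᵥ y') i) = IsLocalRing.residue R (y' i) :=
      fun h => by
        have := congrFun (hy h h.2) i
        simpa [Matrix.mulVec, dotProduct] using this
    have h2 : IsLocalRing.residue R (u⁻¹ : Rˣ).1 * Fintype.card H = 1 := by
      rw [← map_natCast (IsLocalRing.residue R), ← hu, ← map_mul, Units.inv_mul, map_one]
    simp only [Function.comp_apply, Pi.smul_apply, Finset.sum_apply, smul_eq_mul, map_mul, map_sum,
      h1, Finset.sum_const, Finset.card_univ, nsmul_eq_mul]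
    rw [← mul_assoc, h2, one_mul]

/-- The composite of `e` with reduction is an injective endomorphism of a finite field, hence
bijective, though not assumed to be the identity. Writing `y` as the image of `t`, the vector `e ∘
t` is a fixed lift because `ρ` has entries in the image of `e`. -/
theorem exists_fixed_lift_of_constant [Finite (IsLocalRing.ResidueField R)]
    (ρ : G →* GL (Fin n) R) (e : IsLocalRing.ResidueField R →+* R)
    (r : G →* GL (Fin n) (IsLocalRing.ResidueField R))
    (hr : ∀ g i j, (ρ g).1 i j = e ((r g).1 i j)) (H : Subgroup G)
    (y : Fin n → IsLocalRing.ResidueField R)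
    (hy : ∀ h ∈ H, (ρ h).1.map (IsLocalRing.residue R) *ᵥ y = y) :
    ∃ w, (∀ h ∈ H, (ρ h).1 *ᵥ w = w) ∧ IsLocalRing.residue R ∘ w = y := by
  let s := (IsLocalRing.residue R).comp e
  have hs : Function.Bijective s := ⟨s.injective, Finite.surjective_of_injective s.injective⟩
  obtain ⟨t, rfl⟩ : ∃ t, s ∘ t = y :=
    ⟨fun i => (hs.2 (y i)).choose, funext fun i => (hs.2 (y i)).choose_spec⟩
  refine ⟨e ∘ t, fun h hh => ?_, rfl⟩
  funext i
  have h1 : ((r h).1 *ᵥ t) i = t i := hs.1 <| by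
    have := congrFun (hy h hh) i
    simpa [Matrix.mulVec, dotProduct, hr, s] using this
  rw [Function.comp_apply, ← h1]
  simp [Matrix.mulVec, dotProduct, hr]

/-- Any set-theoretic section of reduction, applied to each coordinate, commutes with permuting
coordinates. -/
theorem exists_fixed_lift_of_perm (ρ : G →* GL (Fin n) R)
    (hρ : ∀ g, ∃ σ : Equiv.Perm (Fin n), (ρ g).1 = σ.permMatrix R) (H : Subgroup G)
    (y : Fin n → IsLocalRing.ResidueField R)
    (hy : ∀ h ∈ H, (ρ h).1.map (IsLocalRing.residue R) *ᵥ y = y) :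
    ∃ w, (∀ h ∈ H, (ρ h).1 *ᵥ w = w) ∧ IsLocalRing.residue R ∘ w = y := by
  obtain ⟨s, hs⟩ := (IsLocalRing.residue_surjective (R := R)).hasRightInverse
  refine ⟨s ∘ y, fun h hh => ?_, funext fun i => hs _⟩
  obtain ⟨σ, hσ⟩ := hρ h
  have h1 := hy h hh
  have h2 : (ρ h).1.map (IsLocalRing.residue R) =
      σ.permMatrix (IsLocalRing.ResidueField R) := by
    rw [hσ]
    ext i j
    simp [Equiv.toPEquiv_apply, PEquiv.toMatrix_apply, apply_ite (IsLocalRing.residue R)]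
  rw [h2, Matrix.permMatrix_mulVec] at h1
  rw [hσ, Matrix.permMatrix_mulVec, Function.comp_assoc, h1]

end Lifting

/-! ### Dimension of the special fibre and codimension of the fixed locus. -/

section Fibre

open AlgebraicGeometry CategoryTheory

/-- The dimension of the fibre of a morphism of affine schemes over a closed point. -/
theorem topologicalKrullDim_fiber_specMap {S T : Type u} [CommRing S] [CommRing T] (ψ : S →+* T)
    (y : PrimeSpectrum S) (hy : y.asIdeal.IsMaximal) (s : Set S) (hs : Ideal.span s = y.asIdeal) :
    topologicalKrullDim
        ((Spec.map (CommRingCat.ofHom ψ) : Spec (CommRingCat.of T) ⟶ Spec (CommRingCat.of S)).fiber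
          y) = ringKrullDim (T ⧸ Ideal.span (ψ '' s)) := by
  set J := Ideal.span (ψ '' s)
  have hemb := PrimeSpectrum.isClosedEmbedding_comap_of_surjective _ (Ideal.Quotient.mk J)
    Ideal.Quotient.mk_surjective
  have hrange : Set.range (PrimeSpectrum.comap (Ideal.Quotient.mk J)) =
      PrimeSpectrum.comap ψ ⁻¹' {y} := by
    rw [range_comap_of_surjective _ _ Ideal.Quotient.mk_surjective, Ideal.mk_ker]
    ext x
    rw [PrimeSpectrum.mem_zeroLocus, SetLike.coe_subset_coe, Set.mem_preimage,
      Set.mem_singleton_iff, PrimeSpectrum.ext_iff, PrimeSpectrum.comap_asIdeal]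
    -- A prime contains `J` exactly when its contraction contains `y`, and maximality of `y` turns
    -- this inclusion into equality.
    have hJ : J ≤ x.asIdeal ↔ y.asIdeal ≤ x.asIdeal.comap ψ := by
      rw [← hs, ← Ideal.map_le_iff_le_comap, Ideal.map_span]
    rw [hJ]
    exact ⟨fun h => (hy.eq_of_le (Ideal.IsPrime.ne_top (Ideal.comap_isPrime _ _)) h).symm,
      fun h => h.ge⟩
  let e : PrimeSpectrum (T ⧸ J) ≃ₜ (PrimeSpectrum.comap ψ ⁻¹' {y} : Set (PrimeSpectrum T)) :=
    hemb.isEmbedding.toHomeomorph.trans (.setCongr hrange)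
  rw [← PrimeSpectrum.topologicalKrullDim_eq_ringKrullDim,
    IsHomeomorph.topologicalKrullDim_eq _ e.isHomeomorph]
  exact IsHomeomorph.topologicalKrullDim_eq _
    ((Spec.map (CommRingCat.ofHom ψ)).fiberHomeo y).isHomeomorph

end Fibre

section SpecialFibreIdeals

open Matrix

variable {K : Type*} [Field K] [ValuativeRel K] {n : ℕ}

theorem isMaximal_origin : (origin K n).asIdeal.IsMaximal := by
  have h1 : (⊥ : PrimeSpectrum 𝓀[K]).asIdeal = ⊥ := rfl
  rw [origin, PrimeSpectrum.comap_asIdeal, h1]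
  refine RingHom.ker_isMaximal_of_surjective _ fun a => ⟨a ⊗ₜ 1, ?_⟩
  simp

theorem span_range_tmul_X_eq_origin :
    Ideal.span (Set.range fun i => (1 ⊗ₜ MvPolynomial.X i : SpecialCoordRing K n)) =
      (origin K n).asIdeal := by
  let ev : SpecialCoordRing K n →ₐ[𝓀[K]] 𝓀[K] :=
    Algebra.TensorProduct.lift (AlgHom.id 𝓀[K] 𝓀[K])
      (MvPolynomial.aeval (R := 𝒪[K]) (fun _ : Fin n => (0 : 𝓀[K])))
      (fun _ _ => Commute.all _ _)
  have hmem : ∀ t, t ∈ (origin K n).asIdeal ↔ ev t = 0 := fun t => Iff.rfl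
  apply le_antisymm
  · rw [Ideal.span_le]
    rintro _ ⟨i, rfl⟩
    exact (hmem _).mpr (by simp [ev])
  · intro t ht
    set J := Ideal.span (Set.range fun i => (1 ⊗ₜ MvPolynomial.X i : SpecialCoordRing K n))
    -- Every element differs from its value at the origin by an element of the ideal of the
    -- coordinates.
    have key : ∀ t, t - algebraMap 𝓀[K] _ (ev t) ∈ J := fun t => by
      induction t using TensorProduct.induction_on with
      | zero => simp
      | add x y hx hy =>
        rw [map_add, map_add, add_sub_add_comm]
        exact J.add_mem hx hy
      | tmul a p =>
        induction p using MvPolynomial.induction_on with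
        | C r =>
          have h1 : (a ⊗ₜ MvPolynomial.C r : SpecialCoordRing K n) =
              algebraMap 𝓀[K] _ (ev (a ⊗ₜ MvPolynomial.C r)) := by
            rw [← MvPolynomial.algebraMap_eq, Algebra.algebraMap_eq_smul_one, TensorProduct.tmul_smul,
              TensorProduct.smul_tmul']
            simp [ev]
          rw [← h1, sub_self]
          exact J.zero_mem
        | add p q hp hq =>
          rw [TensorProduct.tmul_add, map_add, map_add, add_sub_add_comm]
          exact J.add_mem hp hq
        | mul_X p i _ =>
          have h1 : (a ⊗ₜ (p * MvPolynomial.X i) : SpecialCoordRing K n) =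
              (a ⊗ₜ p) * (1 ⊗ₜ MvPolynomial.X i) := by simp
          have h2 : ev (1 ⊗ₜ MvPolynomial.X i) = 0 := by simp [ev]
          rw [h1, map_mul, h2, mul_zero, map_zero, sub_zero]
          exact J.mul_mem_left _ (Ideal.subset_span ⟨i, rfl⟩)
    have := key t
    rwa [(hmem t).mp ht, map_zero, sub_zero] at this

/-- Modulo the forms `h xᵢ - xᵢ` the action of `h` and the identity agree on algebra generators,
hence everywhere; so these linear forms generate the whole ideal. -/
theorem map_fixedIdeal {G : Type*} [Group G] (ρ : G →* GL (Fin n) 𝒪[K]) (H : Subgroup G) :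
    (fixedIdeal ρ H).map (MvPolynomial.algebraTensorAlgEquiv 𝒪[K] 𝓀[K]).toRingEquiv =
      Ideal.span (linForm '' fixedForms ρ H (algebraMap 𝒪[K] 𝓀[K])) := by
  set e := MvPolynomial.algebraTensorAlgEquiv (σ := Fin n) 𝒪[K] 𝓀[K]
  set I := Ideal.span (linForm '' fixedForms ρ H (algebraMap 𝒪[K] 𝓀[K]))
  have hX : ∀ h i, e (Algebra.TensorProduct.map (AlgHom.id 𝒪[K] 𝓀[K]) (coordAct ρ h)
      (1 ⊗ₜ MvPolynomial.X i)) - e (1 ⊗ₜ MvPolynomial.X i) =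
        linForm (((ρ h).1.map (algebraMap 𝒪[K] 𝓀[K]) - 1) i) := fun h i => by
    have h1 : (((ρ h).1.map (algebraMap 𝒪[K] 𝓀[K]) - 1) i) =
        fun j => algebraMap 𝒪[K] 𝓀[K] ((ρ h).1 i j) - if i = j then 1 else 0 := by
      funext j
      simp [Matrix.one_apply]
    rw [h1]
    simp [e, coordAct, linForm, sub_mul, Finset.sum_sub_distrib, apply_ite MvPolynomial.C, ite_mul]
  rw [fixedIdeal, Ideal.map_span]
  apply le_antisymm
  · rw [Ideal.span_le]
    rintro _ ⟨_, ⟨h, hh, f, rfl⟩, rfl⟩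
    have h1 : ((Ideal.Quotient.mkₐ 𝒪[K] I).comp (e.toAlgHom.restrictScalars 𝒪[K])).comp
        (Algebra.TensorProduct.map (AlgHom.id 𝒪[K] 𝓀[K]) (coordAct ρ h)) =
        (Ideal.Quotient.mkₐ 𝒪[K] I).comp (e.toAlgHom.restrictScalars 𝒪[K]) := by
      apply Algebra.TensorProduct.ext
      · ext a
        simp
      · ext i
        refine (Ideal.Quotient.mk_eq_mk_iff_sub_mem _ _).mpr ?_
        exact (hX h i).symm ▸ Ideal.subset_span ⟨_, ⟨h, hh, i, rfl⟩, rfl⟩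
    have h2 := (Ideal.Quotient.mk_eq_mk_iff_sub_mem _ _).mp (DFunLike.congr_fun h1 f)
    change e _ ∈ I
    rw [map_sub]
    exact h2
  · rw [Ideal.span_le]
    rintro _ ⟨_, ⟨h, hh, i, rfl⟩, rfl⟩
    rw [← hX, ← map_sub]
    exact Ideal.subset_span ⟨_, ⟨h, hh, _, rfl⟩, rfl⟩

theorem height_fixedIdeal_add_finrank {G : Type*} [Group G] (ρ : G →* GL (Fin n) 𝒪[K])
    (H : Subgroup G) : (fixedIdeal ρ H).height +
      Module.finrank 𝓀[K] (linZeros (fixedForms ρ H (algebraMap 𝒪[K] 𝓀[K]))) = n := by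
  rw [← height_span_linForm_add_finrank (fixedForms ρ H (algebraMap 𝒪[K] 𝓀[K])), ← map_fixedIdeal,
    RingEquiv.height_map]

end SpecialFibreIdeals

theorem exists_ringHom_residueField_tensorProduct {R S B : Type*} [CommRing R] [IsLocalRing R]
    [CommRing S] [Algebra R S] [CommRing B] (g : S →+* B)
    (hg : ∀ a ∈ IsLocalRing.maximalIdeal R, g (algebraMap R S a) = 0) :
    ∃ q : IsLocalRing.ResidueField R ⊗[R] S →+* B, ∀ p, q (1 ⊗ₜ p) = g p := by
  let := (g.comp (algebraMap R S)).toAlgebra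
  let gR : S →ₐ[R] B := { g with commutes' := fun _ => rfl }
  let f : IsLocalRing.ResidueField R →+* B := Ideal.Quotient.lift _ (g.comp (algebraMap R S)) hg
  let fR : IsLocalRing.ResidueField R →ₐ[R] B := { f with commutes' := fun _ => rfl }
  refine ⟨(Algebra.TensorProduct.lift fR gR fun _ _ => Commute.all _ _).toRingHom, fun p => ?_⟩
  refine (Algebra.TensorProduct.lift_tmul _ _ _ _ _).trans ?_
  rw [map_one, one_mul]
  rfl

/-- The dimension of a closed subscheme of a thickening of an affine space cut out by linear
forms. -/
theorem ringKrullDim_quotient_span_image_linForm {A T κ : Type u} [CommRing A] [CommRing T]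
    [Field κ] {n : ℕ} (Λ : Set (Fin n → A)) (ι : MvPolynomial (Fin n) A →+* T)
    (hι : Function.Surjective ι) (θ : A →+* κ) (hθ : Function.Surjective θ)
    (q : T →+* MvPolynomial (Fin n) κ) (hq : ∀ p, q (ι p) = MvPolynomial.map θ p)
    (H : ∀ Q : Ideal T, Q.IsPrime → ∃ θ' : A →+* κ, Function.Surjective θ' ∧
      (∀ a, θ' a = 0 → ι (MvPolynomial.C a) ∈ Q) ∧
      linZeros ((θ' ∘ ·) '' Λ) = linZeros ((θ ∘ ·) '' Λ)) :
    ringKrullDim (T ⧸ Ideal.span ((fun a => ι (linForm a)) '' Λ)) =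
      Module.finrank κ (linZeros ((θ ∘ ·) '' Λ)) := by
  set J := Ideal.span ((fun a => ι (linForm a)) '' Λ)
  set I := Ideal.span (linForm '' ((θ ∘ ·) '' Λ))
  -- The reduction `q` yields the quotient bounding the dimension from below; the bound from above
  -- comes from `H`, applied to the primes containing `J`.
  have hqJ : ∀ x ∈ J, (Ideal.Quotient.mk I).comp q x = 0 := by
    refine fun x hx =>
      (Ideal.span_le (I := RingHom.ker ((Ideal.Quotient.mk I).comp q))).mpr ?_ hx
    rintro _ ⟨a, ha, rfl⟩
    have h1 : MvPolynomial.map θ (linForm a) = linForm (θ ∘ a) := by simp [linForm]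
    refine Ideal.Quotient.eq_zero_iff_mem.mpr ?_
    rw [hq, h1]
    exact Ideal.subset_span ⟨_, ⟨a, ha, rfl⟩, rfl⟩
  have hqs : Function.Surjective ((Ideal.Quotient.mk I).comp q) := fun y => by
    obtain ⟨y, rfl⟩ := Ideal.Quotient.mk_surjective y
    obtain ⟨p, rfl⟩ := MvPolynomial.map_surjective θ hθ y
    exact ⟨_, congrArg _ (hq p)⟩
  refine ringKrullDim_eq_of_forall_finrank_linZeros Λ ((Ideal.Quotient.mk J).comp ι)
    (Ideal.Quotient.mk_surjective.comp hι) (fun a ha => ?_) (fun p => ?_) θ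
    (Ideal.Quotient.lift J _ hqJ)
    (Ideal.Quotient.lift_surjective_of_surjective _ hqJ hqs) rfl
  · exact Ideal.Quotient.eq_zero_iff_mem.mpr (Ideal.subset_span ⟨a, ha, rfl⟩)
  · obtain ⟨θ', hs, h0, hz⟩ := H _ (Ideal.comap_isPrime (Ideal.Quotient.mk J) p.asIdeal)
    exact ⟨κ, inferInstance, θ', hs, h0, by rw [hz]⟩

/-- The special fibre of a subscheme of an affine space over `A` cut out by linear forms. -/
theorem ringKrullDim_residueField_tensorProduct_quotient {R A κ : Type u} [CommRing R]
    [IsLocalRing R] [CommRing A] [Algebra R A] {n : ℕ} (Λ : Set (Fin n → A)) [Field κ] (θ : A →+* κ)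
    (hθs : Function.Surjective θ) (hθ : ∀ a ∈ IsLocalRing.maximalIdeal R, θ (algebraMap R A a) = 0)
    (H : ∀ Q : Ideal A, Q.IsPrime → Q.under R = IsLocalRing.maximalIdeal R →
      ∃ θ' : A →+* κ, Function.Surjective θ' ∧ (∀ a, θ' a = 0 → a ∈ Q) ∧
        linZeros ((θ' ∘ ·) '' Λ) = linZeros ((θ ∘ ·) '' Λ)) :
    ringKrullDim ((IsLocalRing.ResidueField R ⊗[R] MvPolynomial (Fin n) A) ⧸
        Ideal.span ((fun a => (1 : IsLocalRing.ResidueField R) ⊗ₜ[R] linForm a) '' Λ)) =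
      Module.finrank κ (linZeros ((θ ∘ ·) '' Λ)) := by
  let ι : MvPolynomial (Fin n) A →+* IsLocalRing.ResidueField R ⊗[R] MvPolynomial (Fin n) A :=
    (Algebra.TensorProduct.includeRight : MvPolynomial (Fin n) A →ₐ[R] _).toRingHom
  have hι : Function.Surjective ι :=
    Algebra.TensorProduct.includeRight_surjective _ IsLocalRing.residue_surjective
  have hιR : ∀ a ∈ IsLocalRing.maximalIdeal R,
      ι (MvPolynomial.C (algebraMap R A a)) = 0 := fun a ha => by
    have h2 : algebraMap R (IsLocalRing.ResidueField R) a = 0 :=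
      Ideal.Quotient.eq_zero_iff_mem.mpr ha
    have h3 := (Algebra.TensorProduct.includeRight : MvPolynomial (Fin n) A →ₐ[R]
      IsLocalRing.ResidueField R ⊗[R] MvPolynomial (Fin n) A).commutes a
    refine h3.trans ?_
    rw [Algebra.TensorProduct.algebraMap_apply, h2, TensorProduct.zero_tmul]
  obtain ⟨q, hq⟩ := exists_ringHom_residueField_tensorProduct (R := R)
    (MvPolynomial.map (σ := Fin n) θ) fun a ha => by
      rw [IsScalarTower.algebraMap_apply R A (MvPolynomial (Fin n) A), MvPolynomial.algebraMap_eq,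
        MvPolynomial.map_C, hθ a ha, map_zero]
  refine ringKrullDim_quotient_span_image_linForm Λ ι hι θ hθs q hq fun Q hQ => ?_
  refine H (Q.comap (ι.comp MvPolynomial.C)) (Ideal.comap_isPrime _ _) ?_
  refine ((IsLocalRing.maximalIdeal.isMaximal R).eq_of_le
    (Ideal.IsPrime.ne_top (Ideal.comap_isPrime _ _)) fun a ha => ?_).symm
  change ι (MvPolynomial.C (algebraMap R A a)) ∈ Q
  rw [hιR a ha]
  exact Ideal.zero_mem _

/-- The special fibre over the origin is cut out by the linear forms `∑ⱼ φⱼ(xᵢ) yⱼ`. -/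
theorem topologicalKrullDim_etaSpecial_fiber_origin {K M : Type u} [Field K] [ValuativeRel K]
    [CommRing M] [Algebra K M] {n : ℕ}
    (φ : Fin n → ((Fin n → 𝒪[K]) →ₗ[𝒪[K]] integralClosure 𝒪[K] M)) :
    topologicalKrullDim ((etaSpecial φ).fiber (origin K n)) =
      ringKrullDim ((𝓀[K] ⊗[𝒪[K]] MvPolynomial (Fin n) (integralClosure 𝒪[K] M)) ⧸
        Ideal.span ((fun a => (1 : 𝓀[K]) ⊗ₜ[𝒪[K]] linForm a) '' Set.range fun i j => φ j (Pi.single i 1))) := by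
  refine (topologicalKrullDim_fiber_specMap _ (origin K n) isMaximal_origin _
    span_range_tmul_X_eq_origin).trans ?_
  rw [← Set.range_comp, ← Set.range_comp]
  have h1 : ∀ i, (Algebra.TensorProduct.map (AlgHom.id 𝒪[K] 𝓀[K]) (untwist φ)).toRingHom
      (1 ⊗ₜ MvPolynomial.X i) = (1 : 𝓀[K]) ⊗ₜ[𝒪[K]] linForm fun j => φ j (Pi.single i 1) := fun i => by
    simp [untwist, linForm]
  have h2 : (Algebra.TensorProduct.map (AlgHom.id 𝒪[K] 𝓀[K]) (untwist φ)).toRingHom ∘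
      (fun i => (1 : 𝓀[K]) ⊗ₜ[𝒪[K]] MvPolynomial.X i) =
      (fun a => (1 : 𝓀[K]) ⊗ₜ[𝒪[K]] linForm a) ∘ fun i j => φ j (Pi.single i 1) := funext h1
  rw [h2]

section FibreDimension

open Matrix

variable {K M : Type u} {G : Type v} [Field K] [ValuativeRel K] [TopologicalSpace K]
  [IsNonarchimedeanLocalField K] [Group G] {n : ℕ} [CommRing M] [Algebra K M]
  [MulSemiringAction Gᵐᵒᵖ M] [SMulCommClass Gᵐᵒᵖ K M] [IsGEtale K G M]

/-- A maximal ideal of the ring of integers over `𝓂[K]` whose inertia group is the stabilizer of a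
given geometric component. -/
theorem exists_isMaximal_mem_geomStabilizer_iff (z : PrimeSpectrum (M ⊗[K] maxUnramified K)) :
    ∃ P : Ideal (integralClosure 𝒪[K] M), P.IsMaximal ∧
      P.under 𝒪[K] = 𝓂[K] ∧
      ∀ g, g ∈ geomStabilizer K M G z ↔ ∀ a, op g • a - a ∈ P := by
  have : Algebra.Etale K M := IsGEtale.etale G
  have : Module.Finite K M := IsGEtale.finite G
  obtain ⟨χ, hχ⟩ := exists_geomPoint (Ω := SeparableClosure K) z
  obtain ⟨𝔫, hp, hinv, h𝔫⟩ : ∃ 𝔫 : Ideal (integralClosure 𝒪[K] (SeparableClosure K)), 𝔫.IsPrime ∧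
      (∀ (τ : SeparableClosure K ≃ₐ[K] SeparableClosure K)
        (x y : integralClosure 𝒪[K] (SeparableClosure K)), (y : SeparableClosure K) = τ x →
          x ∈ 𝔫 → y ∈ 𝔫) ∧
      ∀ a ∈ 𝓂[K], algebraMap 𝒪[K] (integralClosure 𝒪[K] (SeparableClosure K)) a ∈ 𝔫 :=
    exists_invariant_prime K (SeparableClosure K)
  let χ' := (χ.restrictScalars 𝒪[K]).mapIntegralClosure
  let P : Ideal (integralClosure 𝒪[K] M) := 𝔫.comap χ'
  have hP : P.under 𝒪[K] = 𝓂[K] := by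
    refine ((IsLocalRing.maximalIdeal.isMaximal 𝒪[K]).eq_of_le
      (Ideal.IsPrime.ne_top (Ideal.comap_isPrime _ _)) fun a ha => ?_).symm
    change χ' (algebraMap 𝒪[K] _ a) ∈ 𝔫
    rw [AlgHom.commutes]
    exact h𝔫 a ha
  have : P.IsPrime := Ideal.comap_isPrime _ _
  refine ⟨P, Ideal.isMaximal_of_isIntegral_of_isMaximal_comap (R := 𝒪[K]) P
    (Eq.subst (motive := Ideal.IsMaximal) hP.symm (IsLocalRing.maximalIdeal.isMaximal 𝒪[K])), hP, fun g => ?_⟩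
  rw [mem_geomStabilizer_iff_forall_op_smul_sub_mem hχ 𝔫 hinv h𝔫]
  simp only [P, Ideal.mem_comap, map_sub]
  rfl

/-- The ring `𝒪_M ⊗ k` may be non-reduced with several points, so one prime `P` does not suffice:
the zero space must be compared at all primes above `𝓂[K]`. -/
theorem topologicalKrullDim_fiber_add_finrank [Finite G] {ρ : G →* GL (Fin n) 𝒪[K]} {I : Subgroup G}
    {P : Ideal (integralClosure 𝒪[K] M)} (hPm : P.IsMaximal) (hP : P.under 𝒪[K] = 𝓂[K])
    (hI : ∀ g, g ∈ I ↔ ∀ a, op g • a - a ∈ P)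
    (hlift : ∀ y ∈ linZeros (fixedForms ρ I (algebraMap 𝒪[K] 𝓀[K])),
      ∃ w, (∀ h ∈ I, (ρ h).1 *ᵥ w = w) ∧ algebraMap 𝒪[K] 𝓀[K] ∘ w = y)
    (φ : Module.Basis (Fin n) 𝒪[K] (tuningModule ρ M)) :
    ∃ d : ℕ, topologicalKrullDim
        ((etaSpecial fun j => (φ j : (Fin n → 𝒪[K]) →ₗ[𝒪[K]] integralClosure 𝒪[K] M)).fiber
          (origin K n)) = d ∧
      d + Module.finrank 𝓀[K] (linZeros (fixedForms ρ I (algebraMap 𝒪[K] 𝓀[K]))) = n := by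
  let A := integralClosure 𝒪[K] M
  let := Ideal.Quotient.field P
  let θ : A →+* A ⧸ P := Ideal.Quotient.mk P
  let f : 𝓀[K] →+* A ⧸ P := Ideal.Quotient.lift _ (θ.comp (algebraMap 𝒪[K] A)) fun a ha =>
    Ideal.Quotient.eq_zero_iff_mem.mpr (hP.ge ha)
  have hf : f.comp (algebraMap 𝒪[K] 𝓀[K]) = θ.comp (algebraMap 𝒪[K] A) := rfl
  let b := φ.map (tuningModuleEquiv M ρ)
  let w : Fin n → Fin n → A := fun j => b j
  have hwφ : ∀ j i, w j i = (φ j).1 (Pi.single i 1) := fun j i => tuningModuleEquiv_apply ρ _ i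
  have hw : Submodule.span 𝒪[K] (Set.range w) = equivariantVectors A ρ := by
    have h1 : Set.range w = (equivariantVectors A ρ).subtype '' Set.range b := by
      rw [← Set.range_comp]
      rfl
    rw [h1, ← Submodule.map_span, b.span_eq, Submodule.map_subtype_top]
  refine ⟨_, ?_, finrank_linZeros_add_finrank_linZeros_fixedForms (θ := θ) (v := w)
    (fun g => by
      rw [hI]
      exact forall_congr' fun a => (Ideal.Quotient.mk_eq_mk_iff_sub_mem _ _).symm) hf hlift hw⟩
  rw [topologicalKrullDim_etaSpecial_fiber_origin]
  have hΛ : (Set.range fun i j => (φ j).1 (Pi.single i 1)) = Set.range fun i j => w j i := by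
    simp only [hwφ]
  rw [hΛ]
  refine ringKrullDim_residueField_tensorProduct_quotient _ θ Ideal.Quotient.mk_surjective
    (fun a ha => Ideal.Quotient.eq_zero_iff_mem.mpr (hP.ge ha)) fun Q hQ hQP => ?_
  have : Finite Gᵐᵒᵖ := Finite.of_equiv G MulOpposite.opEquiv
  -- `Q` is a conjugate `γ • P`, so `θ` composed with `γ⁻¹` has kernel `Q`, and conjugation leaves
  -- the zero space unchanged.
  obtain ⟨γ, hγ⟩ := Algebra.IsInvariant.exists_smul_of_under_eq 𝒪[K] A Gᵐᵒᵖ P Q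
    (hP.trans hQP.symm)
  refine ⟨θ.comp (MulSemiringAction.toRingHom Gᵐᵒᵖ A (op (unop γ⁻¹))),
    Ideal.Quotient.mk_surjective.comp (MulAction.surjective _), fun a ha => ?_,
    linZeros_comp_op_smul θ _ fun j => (b j).2⟩
  have h1 : γ⁻¹ • a ∈ P := Ideal.Quotient.eq_zero_iff_mem.mp ha
  rw [hγ]
  exact Ideal.mem_pointwise_smul_iff_inv_smul_mem.mpr h1

end FibreDimension

theorem mainTheorem10 {K M : Type u} {G : Type v} [Field K] [ValuativeRel K] [TopologicalSpace K]
    [IsNonarchimedeanLocalField K] [Group G] [Finite G] (n : ℕ) (ρ : G →* GL (Fin n) 𝒪[K])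
    (hρ :
      ¬ ringChar 𝓀[K] ∣ Nat.card G ∨
      (∃ (e : PowerSeries 𝓀[K] ≃+* 𝒪[K]) (r : G →* GL (Fin n) 𝓀[K]),
        ∀ g i j, (ρ g).1 i j = e (PowerSeries.C ((r g).1 i j))) ∨
      (∀ g, ∃ σ : Equiv.Perm (Fin n), (ρ g).1 = σ.permMatrix 𝒪[K]))
    [CommRing M] [Algebra K M] [MulSemiringAction Gᵐᵒᵖ M] [SMulCommClass Gᵐᵒᵖ K M]
    [IsGEtale K G M] (z : PrimeSpectrum (M ⊗[K] maxUnramified K)) :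
    Nonempty (Module.Basis (Fin n) 𝒪[K] (tuningModule ρ M)) ∧
    ∀ φ : Module.Basis (Fin n) 𝒪[K] (tuningModule ρ M),
      topologicalKrullDim
          ((etaSpecial fun j => (φ j : (Fin n → 𝒪[K]) →ₗ[𝒪[K]] integralClosure 𝒪[K] M)).fiber
            (origin K n)) =
        ((fixedIdeal ρ (geomStabilizer K M G z)).height : WithBot ℕ∞) := by
  have : Module.Finite K M := IsGEtale.finite G
  have : Algebra.Etale K M := IsGEtale.etale G
  obtain ⟨χ, -⟩ := exists_geomPoint (Ω := SeparableClosure K) z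
  refine ⟨nonempty_basis_tuningModule ρ χ, fun φ => ?_⟩
  obtain ⟨P, hPmax, hP, hI⟩ := exists_isMaximal_mem_geomStabilizer_iff (G := G) z
  obtain ⟨d, hd, hdn⟩ := topologicalKrullDim_fiber_add_finrank hPmax hP hI (fun y hy => by
    rw [mem_linZeros_fixedForms] at hy
    rcases hρ with hG | ⟨e, r, hr⟩ | hσ
    · exact exists_fixed_lift_of_not_dvd ρ hG _ y hy
    · exact exists_fixed_lift_of_constant ρ ((e : PowerSeries 𝓀[K] →+* 𝒪[K]).comp PowerSeries.C) r
        hr _ y hy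
    · exact exists_fixed_lift_of_perm ρ hσ _ y hy) φ
  rw [hd]
  have h1 := height_fixedIdeal_add_finrank ρ (geomStabilizer K M G z)
  have h2 : (d : ℕ∞) + Module.finrank 𝓀[K] (linZeros (fixedForms ρ (geomStabilizer K M G z)
      (algebraMap 𝒪[K] 𝓀[K]))) = n := by exact_mod_cast hdn
  -- Fibre dimension and height both add up to `n` with the finite dimension of the fixed space,
  -- which cancels in `ℕ∞`.
  have h3 := WithTop.add_right_cancel (ENat.natCast_ne_top _) (h1.trans h2.symm)
  rw [h3]
  rfl

end
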